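/- Let $X_{600}$ be the boundary complex of the regular convex $4$-polytope with Schläfli symbol $\{3,3,5\}$ (the $600$-cell), regarded as a combinatorial simplicial complex; it has $120$ vertices and $600$ three-dimensional simplices. For a $3$-simplex $\sigma$ of $X_{600}$, let $X_{543}$ be the subcomplex of $X_{600}$ obtained by removing the interiors of all simplices which intersect $\sigma$ (that is, $X_{543}$ consists of the simplices of $X_{600}$ having no vertex in common with $\sigma$). An acute triangulation of a polyhedron $P\subset\mathbb{R}^3$ is a finite geometric simplicial complex with underlying space $P$, consisting of tetrahedra and their faces, such that all dihedral angles of all the tetrahedra are smaller than $\pi/2$. Two simplicial complexes are combinatorially equivalent if there is a bijection between their vertex sets that induces a bijection between their simplices. Theorem. Let $\sigma$ be any $3$-simplex of $X_{600}$ and let $X_{543}$ be the corresponding complex. Each of the following two tetrahedra has an acute triangulation which is combinatorially equivalent to $X_{543}$, has exactly $543$ tetrahedra (in particular, it is non-trivial), and all of whose vertices have integer coordinates: (i) the regular $3$-simplex with vertices $(60000,0,0)$, $(60000,60000,60000)$, $(0,0,60000)$, $(0,60000,0)$; (ii) the standard (cube-corner) $3$-simplex with vertices $(0,0,0)$, $(60000,0,0)$,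 $(0,60000,0)$, $(0,0,60000)$. -/

import Mathlib

namespace AcuteTriangulations

/-- Euclidean `n`-space. -/
abbrev Euc (n : ℕ) : Type := EuclideanSpace ℝ (Fin n)

/-! ### Combinatorial equivalence of simplicial complexes -/

/-- The vertices of a simplicial complex (on an ambient type, not all of whose elements need be
vertices). -/
def vertexSet {α : Type*} (K : PreAbstractSimplicialComplex α) : Set α :=
  {v | {v} ∈ K.faces}

/-- Two simplicial complexes are combinatorially equivalent (simplicially isomorphic) if there is
a bijection between their vertex sets under which a finite set of vertices spans a simplex of the
first complex if and only if its image spans a simplex of the second one. -/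
def CombinatoriallyEquivalent {α β : Type*}
    (K : PreAbstractSimplicialComplex α) (L : PreAbstractSimplicialComplex β) : Prop :=
  ∃ e : vertexSet K ≃ vertexSet L, ∀ s : Finset (vertexSet K),
    s.map (Function.Embedding.subtype _) ∈ K.faces ↔
      s.map (e.toEmbedding.trans (Function.Embedding.subtype _)) ∈ L.faces

/-! ### The 600-cell, its boundary complex, and the complex with 543 tetrahedra -/

/-- The 120 vertices of the (regular) 600-cell inscribed in the unit sphere of `ℝ⁴`: all points
obtained from `(1, 0, 0, 0)`, `(1/2, 1/2, 1/2, 1/2)` and `(φ/2, 1/2, 1/(2φ), 0)`, where `φ` is the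
golden ratio, by even permutations and arbitrary sign changes of the coordinates. -/
def verts600 : Set (Euc 4) :=
  {x | ∃ b ∈ ({![1, 0, 0, 0],
              ![1 / 2, 1 / 2, 1 / 2, 1 / 2],
              ![Real.goldenRatio / 2, 1 / 2, 1 / (2 * Real.goldenRatio), 0]} : Set (Fin 4 → ℝ)),
        ∃ τ : Equiv.Perm (Fin 4), Equiv.Perm.sign τ = 1 ∧
        ∃ ε : Fin 4 → ℤˣ, ∀ i, x (τ i) = ((ε i : ℤ) : ℝ) * b i}

/-- For a full-dimensional convex polytope in `ℝⁿ` with vertex set `V`: the finite set `t` is the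
vertex set of a nonempty proper face, i.e. `t` is the set of the vertices which lie on some
supporting hyperplane `{x | l x = c}`. -/
def IsProperFaceVertexSet {n : ℕ} (V : Set (Euc n)) (t : Finset (Euc n)) : Prop :=
  t.Nonempty ∧ ∃ (l : Euc n →ₗ[ℝ] ℝ) (c : ℝ),
    l ≠ 0 ∧ (∀ v ∈ V, l v ≤ c) ∧ (t : Set (Euc n)) = {v ∈ V | l v = c}

/-- `X₆₀₀`, the boundary complex of the 600-cell, as a combinatorial simplicial complex: its
simplices are the nonempty subsets of the vertex sets of the proper faces of the 600-cell. -/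
def X600 : PreAbstractSimplicialComplex (Euc 4) where
  faces := {s | s.Nonempty ∧ ∃ t, IsProperFaceVertexSet verts600 t ∧ s ⊆ t}
  isRelLowerSet_faces := by
    rintro s ⟨hs, t, ht, hst⟩
    exact ⟨hs, fun u hus hu => ⟨hu, t, ht, hus.trans hst⟩⟩

/-- `X₅₄₃`, for a fixed 3-simplex `σ` of `X₆₀₀`: the subcomplex of `X₆₀₀` obtained by removing (the
interiors of) all simplices which intersect `σ`. -/
def X543 (σ : Finset (Euc 4)) : PreAbstractSimplicialComplex (Euc 4) where
  faces := {s | s ∈ X600.faces ∧ Disjoint s σ}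
  isRelLowerSet_faces := by
    rintro s ⟨hs, hd⟩
    exact ⟨(X600.isRelLowerSet_faces hs).1, fun u hus hu =>
      ⟨(X600.isRelLowerSet_faces hs).2 hus hu, hd.mono_left hus⟩⟩

/-! ### Acute triangulations in three-dimensional space -/

/-- The dihedral angle of the tetrahedron `abcd` at its edge `ab`: the angle between the components
of `c - a` and `d - a` orthogonal to the edge. -/
noncomputable def dihedralAngle (a b c d : Euc 3) : ℝ :=
  InnerProductGeometry.angle
    ((Submodule.span ℝ {b - a})ᗮ.starProjection (c - a))
    ((Submodule.span ℝ {b - a})ᗮ.starProjection (d - a))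

/-- The 3-simplex with vertex set `t` is acute: all its dihedral angles are smaller than `π / 2`. -/
def IsAcuteSimplex (t : Finset (Euc 3)) : Prop :=
  ∀ a ∈ t, ∀ b ∈ t, ∀ c ∈ t, ∀ d ∈ t, [a, b, c, d].Nodup →
    dihedralAngle a b c d < Real.pi / 2

/-- The tetrahedra (3-simplices) of a geometric simplicial complex, as vertex sets. -/
def tetrahedra (K : Geometry.SimplicialComplex ℝ (Euc 3)) : Set (Finset (Euc 3)) :=
  {t | t ∈ K.faces ∧ t.card = 4}

/-- `K` is an acute triangulation of `P ⊆ ℝ³`: a finite simplicial complex, consisting of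
3-simplices and their faces, with underlying space `P`, all of whose 3-simplices are acute. -/
def IsAcuteTriangulation (K : Geometry.SimplicialComplex ℝ (Euc 3)) (P : Set (Euc 3)) : Prop :=
  K.faces.Finite ∧ K.space = P ∧
  (∀ s ∈ K.faces, ∃ t ∈ tetrahedra K, s ⊆ t) ∧
  ∀ t ∈ tetrahedra K, IsAcuteSimplex t

/-- The regular 3-simplex spanned by four pairwise nonadjacent vertices of the cube
`[0, 60000]³`. -/
noncomputable def regularSimplex : Set (Euc 3) :=
  convexHull ℝ {!₂[60000, 0, 0], !₂[60000, 60000, 60000], !₂[0, 0, 60000], !₂[0, 60000, 0]}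

/-- The standard 3-simplex (cube-corner) spanned by a vertex of the cube `[0, 60000]³` and the
three vertices of the cube adjacent to it. -/
noncomputable def standardSimplex : Set (Euc 3) :=
  convexHull ℝ {!₂[0, 0, 0], !₂[60000, 0, 0], !₂[0, 60000, 0], !₂[0, 0, 60000]}

end AcuteTriangulations

/-! The proof is a finite certificate verified by kernel computation, together with the arguments
that make the verification sufficient. The vertices of the 600-cell are numbered below 120 and its
tetrahedra below 600, in such a way that tetrahedron 599 is {116, 117, 118, 119} and the tetrahedra
numbered below 543 avoid it. Both `X543 σ` and the triangulations are described by the index sets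
`tetSet n` with n < 543, and the combinatorial equivalence follows
(`combinatoriallyEquivalent_of_image`).

The polytope. Distinct unit vertices have inner product at most φ/2, with equality inside each
listed tetrahedron. Hence the sum of the four vertices of a tetrahedron is the normal of a
hyperplane supporting the polytope exactly there. Conversely, write a nonzero normal y in terms of
the four vertices of a listed tetrahedron on which the sum of the functional is largest. Comparison
with the four neighbours makes the coefficients nonnegative, so that among all vertices the maximum
is attained only within that tetrahedron (`exists_subset_image_tetSet`). An arbitrary σ is reduced
to tetrahedron 599 by transitivity: two permutations of the vertices preserve the list of
tetrahedra, and a spanning tree leads from 599 to every tetrahedron along them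
(`exists_isLabelling`).

The triangulations. The circumscribed sphere of each of the 543 tetrahedra has all the other points
strictly outside. Lifted to the paraboloid, this says that the affine interpolation of |x|² on a
tetrahedron is smaller than |x|² at the other points. If moreover every facet is shared or lies in
the boundary, the tetrahedra form a regular triangulation (`exists_simplicialComplex_of_regular`),
so neither intersections nor covering need a separate check. Acuteness amounts to six polynomial
inequalities between integers for each tetrahedron. -/

namespace AcuteTriangulations

/-! ### Kernel-friendly arithmetic -/

/-- The conjunction of `f 0, …, f (n - 1)`. -/
noncomputable def allBelow (n : ℕ) (f : ℕ → Bool) : Bool :=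
  Nat.rec true (fun i ih => cond (f i) ih false) n

/-- The disjunction of `f 0, …, f (n - 1)`. -/
noncomputable def anyBelow (n : ℕ) (f : ℕ → Bool) : Bool :=
  Nat.rec false (fun i ih => cond (f i) true ih) n

/-- `k n`, in a form which makes the kernel evaluate `n` first. -/
noncomputable def force (n : ℕ) (k : ℕ → Bool) : Bool :=
  Nat.rec (k 0) (fun m _ => k (Nat.succ m)) n

theorem allBelow_eq_true {n : ℕ} {f : ℕ → Bool} : allBelow n f = true ↔ ∀ i < n, f i = true := by
  induction n with
  | zero => simp [allBelow]
  | succ n ih =>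
    have : allBelow (n + 1) f = (f n && allBelow n f) := by
      change cond (f n) (allBelow n f) false = _
      cases f n <;> rfl
    rw [this, Bool.and_eq_true, ih]
    constructor
    · rintro ⟨h₁, h₂⟩ i hi
      rcases Nat.lt_succ_iff_lt_or_eq.1 hi with h | rfl
      exacts [h₂ i h, h₁]
    · exact fun h => ⟨h n n.lt_succ_self, fun i hi => h i (hi.trans n.lt_succ_self)⟩

theorem anyBelow_eq_true {n : ℕ} {f : ℕ → Bool} : anyBelow n f = true ↔ ∃ i < n, f i = true := by
  induction n with
  | zero => simp [anyBelow]
  | succ n ih =>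
    have : anyBelow (n + 1) f = (f n || anyBelow n f) := by
      change cond (f n) true (anyBelow n f) = _
      cases f n <;> rfl
    rw [this, Bool.or_eq_true, ih]
    constructor
    · rintro (h | ⟨i, hi, h⟩)
      exacts [⟨n, n.lt_succ_self, h⟩, ⟨i, hi.trans n.lt_succ_self, h⟩]
    · rintro ⟨i, hi, h⟩
      rcases Nat.lt_succ_iff_lt_or_eq.1 hi with h' | rfl
      exacts [Or.inr ⟨i, h', h⟩, Or.inl h]

@[simp]
theorem force_eq (n : ℕ) (k : ℕ → Bool) : force n k = k n := by
  cases n <;> rfl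

/-! ### Packed digits, and integers as differences of natural numbers -/

/-- The number with the given digits in base `B`, starting with the lowest one. -/
def pack (B : ℕ) (l : List ℕ) : ℕ :=
  l.foldr (fun d s => d + B * s) 0

/-- The `i`-th digit of `c` in base `B`. -/
def digit (B c i : ℕ) : ℕ :=
  Nat.mod (Nat.div c (Nat.pow B i)) B

/-- The integer `pos - neg`, as a formal difference. -/
structure Diff where
  /-- The minuend. -/
  pos : ℕ
  /-- The subtrahend. -/
  neg : ℕ

namespace Diff

/-- The value of a formal difference. -/
def val (u : Diff) : ℤ := u.pos - u.neg

instance : Add Diff := ⟨fun u v => ⟨Nat.add u.pos v.pos, Nat.add u.neg v.neg⟩⟩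

instance : Sub Diff := ⟨fun u v => ⟨Nat.add u.pos v.neg, Nat.add u.neg v.pos⟩⟩

instance : Mul Diff :=
  ⟨fun u v => ⟨Nat.add (Nat.mul u.pos v.pos) (Nat.mul u.neg v.neg),
    Nat.add (Nat.mul u.pos v.neg) (Nat.mul u.neg v.pos)⟩⟩

/-- Comparison of values. -/
def lt (u v : Diff) : Bool := Nat.blt (Nat.add u.pos v.neg) (Nat.add v.pos u.neg)

/-- Comparison of values. -/
def le (u v : Diff) : Bool := Nat.ble (Nat.add u.pos v.neg) (Nat.add v.pos u.neg)

/-- Equality of values. -/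
def eq (u v : Diff) : Bool := Nat.beq (Nat.add u.pos v.neg) (Nat.add v.pos u.neg)

/-- `k u`, in a form which makes the kernel evaluate `u` first. -/
noncomputable def force (u : Diff) (k : Diff → Bool) : Bool :=
  AcuteTriangulations.force u.pos fun p => AcuteTriangulations.force u.neg fun n => k ⟨p, n⟩

@[simp]
theorem val_mk (p n : ℕ) : val ⟨p, n⟩ = p - n := rfl

@[simp]
theorem val_add (u v : Diff) : (u + v).val = u.val + v.val := by
  change (((u.pos + v.pos : ℕ) : ℤ) - ((u.neg + v.neg : ℕ) : ℤ)) = _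
  simp only [val]; push_cast; ring

@[simp]
theorem val_sub (u v : Diff) : (u - v).val = u.val - v.val := by
  change (((u.pos + v.neg : ℕ) : ℤ) - ((u.neg + v.pos : ℕ) : ℤ)) = _
  simp only [val]; push_cast; ring

@[simp]
theorem val_mul (u v : Diff) : (u * v).val = u.val * v.val := by
  change (((u.pos * v.pos + u.neg * v.neg : ℕ) : ℤ) - ((u.pos * v.neg + u.neg * v.pos : ℕ) : ℤ)) = _
  simp only [val]; push_cast; ring

@[simp]
theorem lt_eq_true {u v : Diff} : lt u v = true ↔ u.val < v.val := by
  change Nat.blt (u.pos + v.neg) (v.pos + u.neg) = true ↔ _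
  rw [Nat.blt_eq]; simp only [val]; omega

@[simp]
theorem le_eq_true {u v : Diff} : le u v = true ↔ u.val ≤ v.val := by
  change Nat.ble (u.pos + v.neg) (v.pos + u.neg) = true ↔ _
  rw [Nat.ble_eq]; simp only [val]; omega

@[simp]
theorem eq_eq_true {u v : Diff} : eq u v = true ↔ u.val = v.val := by
  change Nat.beq (u.pos + v.neg) (v.pos + u.neg) = true ↔ _
  rw [Nat.beq_eq]; simp only [val]; omega

@[simp]
theorem force_eq (u : Diff) (k : Diff → Bool) : u.force k = k u := by
  simp [force]

end Diff

/-- Vectors in `ℤ³`, in terms of formal differences. -/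
structure DiffVec where
  /-- The first coordinate. -/
  x : Diff
  /-- The second coordinate. -/
  y : Diff
  /-- The third coordinate. -/
  z : Diff

namespace DiffVec

instance : Add DiffVec := ⟨fun u v => ⟨u.x + v.x, u.y + v.y, u.z + v.z⟩⟩

instance : Sub DiffVec := ⟨fun u v => ⟨u.x - v.x, u.y - v.y, u.z - v.z⟩⟩

/-- Multiplication by a scalar. -/
def smul (c : Diff) (u : DiffVec) : DiffVec := ⟨c * u.x, c * u.y, c * u.z⟩

/-- The scalar product. -/
def dot (u v : DiffVec) : Diff := u.x * v.x + u.y * v.y + u.z * v.z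

/-- The vector product. -/
def cross (u v : DiffVec) : DiffVec :=
  ⟨u.y * v.z - u.z * v.y, u.z * v.x - u.x * v.z, u.x * v.y - u.y * v.x⟩

/-- `k u`, in a form which makes the kernel evaluate `u` first. -/
noncomputable def force (u : DiffVec) (k : DiffVec → Bool) : Bool :=
  u.x.force fun x => u.y.force fun y => u.z.force fun z => k ⟨x, y, z⟩

@[simp]
theorem force_eq (u : DiffVec) (k : DiffVec → Bool) : u.force k = k u := by
  simp [force]

end DiffVec

/-! ### Data -/

/-- The vertices of the 600-cell: twice the `k`-th coordinate of a vertex is `(a - 2) + (b - 2) φ`,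
where `b` and `a` are the octal digits number `2 k` and `2 k + 1` of the entry. -/
@[irreducible]
def icosianCode : ℕ := pack (8 ^ 8) [
  0o22222202, 0o22224222, 0o22220222, 0o22422222, 0o22022222, 0o42222222, 0o02222222, 0o32323232,
  0o32323212, 0o32321232, 0o32321212, 0o32123232, 0o32123212, 0o32121232, 0o32121212, 0o12323232,
  0o12323212, 0o12321232, 0o12321212, 0o12123232, 0o12123212, 0o12121232, 0o12121212, 0o22133221,
  0o22131223, 0o22131221, 0o22313221, 0o22311223, 0o22311221, 0o13322223, 0o13322221, 0o13122223,
  0o13122221, 0o31322223, 0o31322221, 0o31122223, 0o31122221, 0o32221321, 0o12221323, 0o12221321,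
  0o32223123, 0o32223121, 0o12223123, 0o12223121, 0o13222332, 0o13222132, 0o13222312, 0o13222112,
  0o31222332, 0o31222132, 0o31222312, 0o31222112, 0o22322313, 0o22322113, 0o22122313, 0o22122113,
  0o22322331, 0o22322131, 0o22122331, 0o22122131, 0o32132322, 0o32132122, 0o12132322, 0o12132122,
  0o32312322, 0o32312122, 0o12312322, 0o12312122, 0o22231332, 0o22211332, 0o22231312, 0o22211312,
  0o22233132, 0o22213132, 0o22233112, 0o22213112, 0o13233222, 0o13213222, 0o13231222, 0o13211222,
  0o31233222, 0o31213222, 0o31231222, 0o31211222, 0o32232213, 0o32212213, 0o12232213, 0o12212213,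
  0o32232231, 0o32212231, 0o12232231, 0o12212231, 0o23132232, 0o21132232, 0o23132212, 0o21132212,
  0o23312232, 0o21312232, 0o23312212, 0o21312212, 0o23223213, 0o21223213, 0o23221213, 0o21221213,
  0o23223231, 0o21223231, 0o23221231, 0o21221231, 0o23321322, 0o21321322, 0o23121322, 0o21121322,
  0o23323122, 0o21323122, 0o23123122, 0o21123122, 0o22222242, 0o22133223, 0o22313223, 0o32221323]

/-- The 600 tetrahedra of the 600-cell: an entry consists of four vertex numbers of three decimal
digits. -/
@[irreducible]
def tetCode : ℕ := pack (1000 ^ 4) [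
  23030034, 25034030, 26036032, 28032036, 23026037, 23037030, 8023030037, 26032037, 12026037032,
  23039026, 23034039, 16023039034, 26039036, 20026036039, 9024029040, 13027040031, 25041028,
  25030041, 10025041030, 28041032, 14028032041, 30037041, 32041037, 17024042033, 21027035042,
  25028043, 25043034, 18025034043, 28036043, 22028043036, 34043039, 36039043, 9024040045,
  13027045040, 24027040045, 8023037046, 12026046037, 23026037046, 10025047041, 14028041047,
  25028047041, 17024049042, 21027042049, 24027049042, 24027045049, 16023050039, 20026039050,
  23026050039, 23026046050, 18025043051, 22028051043, 25028043051, 25028051047, 1044052048,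
  9024045053, 17024053049, 2045049053, 24045053049, 1044048054, 13027055045, 21027049055,
  2045055049, 27045049055, 8023046056, 16023056050, 1046050056, 23046056050, 10025057047,
  18025051057, 2047057051, 25047051057, 12026058046, 20026050058, 1046058050, 26046050058,
  14028047059, 22028059051, 2047051059, 28047059051, 1044060052, 7044052060, 1046056060,
  8046060056, 1052060056, 2045053061, 9045061053, 2047061057, 10047057061, 2053057061, 1048052062,
  15048062052, 1050062056, 16050056062, 1052056062, 2049063053, 17049053063, 2051057063,
  18051063057, 2053063057, 1044054064, 11044064054, 1046064058, 12046058064, 1054058064,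
  1044064060, 1046060064, 2045065055, 13045055065, 2047059065, 14047065059, 2055065059, 2045061065,
  2047065061, 1048066054, 19048054066, 1050058066, 20050066058, 1054066058, 1048062066, 1050066062,
  2049055067, 21049067055, 2051067059, 22051059067, 2055059067, 2049067063, 2051063067, 8023070030,
  16023034070, 23030034070, 8023056070, 16023070056, 12026032071, 20026071036, 26032071036,
  12026071058, 20026058071, 9024072029, 17024033072, 24029033072, 9024053072, 17024072053,
  29033072068, 13027031073, 21027073035, 27031073035, 13027073055, 21027055073, 31035069073,
  10025030074, 18025074034, 25030074034, 10025074057, 18025057074, 30034070074, 14028075032,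
  22028036075, 28032036075, 14028059075, 22028075059, 32036075071, 7052076060, 8056060076,
  52056076060, 7052068076, 8056076070, 11054064077, 12058077064, 54058064077, 11054077069,
  12058071077, 9053061078, 10057078061, 53057061078, 9053078072, 10057074078, 13055079065,
  14059065079, 55059079065, 13055073079, 14059079075, 15052062080, 16056080062, 52056062080,
  15052080068, 16056070080, 52056080076, 3068080076, 52068076080, 3070076080, 56070080076,
  19054081066, 20058066081, 54058081066, 19054069081, 20058081071, 54058077081, 4069077081,
  54069081077, 4071081077, 58071077081, 17053082063, 18057063082, 53057082063, 17053072082,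
  18057082074, 53057078082, 3072078082, 53072082078, 3074082078, 57074078082, 21055067083,
  22059083067, 55059067083, 21055083073, 22059075083, 55059083079, 4073083079, 55073079083,
  4075079083, 59075083079, 7029084068, 9029072084, 3068084072, 29068072084, 3068076084, 7068084076,
  3072084078, 9072078084, 11031069085, 13031085073, 4069073085, 31069085073, 4069085077,
  11069077085, 4073079085, 13073085079, 15033068086, 17033086072, 3068072086, 33068086072,
  3068086080, 15068080086, 3072082086, 17072086082, 19035087069, 21035073087, 4069087073,
  35069073087, 4069081087, 19069087081, 4073087083, 21073083087, 8030070088, 10030088074,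
  3070074088, 30070088074, 3070088076, 8070076088, 3074078088, 10074088078, 3076088084, 3078084088,
  12032089071, 14032075089, 4071089075, 32071075089, 4071077089, 12071089077, 4075089079,
  14075079089, 4077085089, 4079089085, 16034090070, 18034074090, 3070090074, 34070074090,
  3070080090, 16070090080, 3074090082, 18074082090, 3080086090, 3082090086, 20036071091,
  22036091075, 4071075091, 36071091075, 4071091081, 20071081091, 4075083091, 22075091083,
  4081091087, 4083087091, 9029092040, 7029092084, 9029084092, 15033093038, 17033042093,
  33038042093, 15033086093, 17033093086, 8030094037, 10030041094, 30037041094, 8030088094,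
  10030094088, 16034039095, 18034095043, 34039095043, 16034095090, 18034090095, 13031040096,
  11031085096, 13031096085, 19035038097, 21035097042, 35038097042, 19035097087, 21035087097,
  38042093097, 12032037098, 14032098041, 32037098041, 12032098089, 14032089098, 37041094098,
  20036099039, 22036043099, 36039043099, 20036091099, 22036099091, 39043099095, 7044060100,
  11044100064, 44060100064, 5092100096, 15038101048, 19038048101, 15048101062, 19048066101,
  48062066101, 15038093101, 19038101097, 6093097101, 38093101097, 9040102045, 13040045102,
  9045102061, 13045065102, 45061065102, 9040092102, 13040102096, 5092096102, 40092102096,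
  17042049103, 21042103049, 17049063103, 21049103067, 49063103067, 17042103093, 21042097103,
  6093103097, 42093097103, 8037104046, 12037046104, 8046104060, 12046064104, 46060064104,
  8037094104, 12037104098, 5094098104, 37094104098, 60064104100, 16039050105, 20039105050,
  16050062105, 20050105066, 50062105066, 16039105095, 20039099105, 6095105099, 39095099105,
  62066101105, 10041047106, 14041106047, 10047061106, 14047106065, 47061106065, 10041106094,
  14041098106, 5094106098, 41094098106, 61065102106, 18043107051, 22043051107, 18051107063,
  22051067107, 51063067107, 18043095107, 22043107099, 6095099107, 43095107099, 63067107103,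
  7060076108, 8060108076, 7076084108, 8076108088, 76084108088, 7084092108, 8088108094, 7060108100,
  5092108100, 7092100108, 8060104108, 5094104108, 8094108104, 5100108104, 60100104108, 15062109080,
  16062080109, 15080109086, 16080090109, 80086090109, 15086109093, 16090095109, 15062101109,
  6093101109, 15093109101, 16062109105, 6095109105, 16095105109, 6101105109, 62101109105,
  11064110077, 12064077110, 11077110085, 12077089110, 77085089110, 11085110096, 12089098110,
  11064100110, 5096100110, 11096110100, 12064110104, 5098110104, 12098104110, 5100104110,
  64100110104, 19066081111, 20066111081, 19081087111, 20081111091, 81087111091, 19087097111,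
  20091111099, 19066111101, 6097111101, 19097101111, 20066105111, 6099105111, 20099111105,
  6101111105, 66101105111, 9061112078, 10061078112, 9078112084, 10078088112, 78084088112,
  9084112092, 10088094112, 9061102112, 5092102112, 9092112102, 10061112106, 5094112106,
  10094106112, 5102106112, 61102112106, 84088112108, 5092112108, 84092108112, 5094108112,
  88094112108, 17063082113, 18063113082, 17082086113, 18082113090, 82086113090, 17086093113,
  18090113095, 17063113103, 6093113103, 17093103113, 18063107113, 6095107113, 18095113107,
  6103113107, 63103107113, 86090109113, 6093109113, 86093113109, 6095113109, 90095109113,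
  13065079114, 14065114079, 13079085114, 14079114089, 79085114089, 13085096114, 14089114098,
  13065114102, 5096114102, 13096102114, 14065106114, 5098106114, 14098114106, 5102114106,
  65102106114, 85089110114, 5096110114, 85096114110, 5098114110, 89098110114, 21067115083,
  22067083115, 21083115087, 22083091115, 83087091115, 21087115097, 22091099115, 21067103115,
  6097103115, 21097115103, 22067115107, 6099115107, 22099107115, 6103107115, 67103115107,
  87091115111, 6097115111, 87097111115, 6099111115, 91099115111, 24029033116, 27031035116,
  24027040116, 24029040116, 27031040116, 24027042116, 24033042116, 27035042116, 33038042116,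
  35038042116, 15033038117, 15038048117, 7044052117, 15048052117, 44048052117, 7029068117,
  15033068117, 29033068117, 7052068117, 15052068117, 29033116117, 33038116117, 19035038118,
  19038048118, 11044054118, 19048054118, 44048054118, 11031069118, 19035069118, 31035069118,
  11054069118, 19054069118, 31035116118, 35038116118, 38048117118, 44048117118, 38116117118,
  7029092119, 29040092119, 11031096119, 31040096119, 40092096119, 7044100119, 11044100119,
  7092100119, 11096100119, 92096100119, 29040116119, 31040116119, 7029117119, 7044117119,
  29116117119, 11031118119, 11044118119, 31116118119, 44117118119, 116117118119]

/-- The tetrahedra across the facets of each tetrahedron, facets being ordered as the opposite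
vertices are in `tetCode`. -/
@[irreducible]
def nbrCode : ℕ := pack (1000 ^ 4) [
  129001010005, 151000017026, 134003007012, 157002028019, 37007005009, 6021000004, 5301035127,
  8022004002, 7320132036, 47012004010, 11030009000, 10306128045, 13031002009, 12326046133,
  546293032137, 547311143033, 40019025017, 18021016001, 17302149038, 20022003016, 19321039155,
  303022017005, 322021007019, 549297138041, 550315042144, 51028026016, 27030001025, 26307049150,
  29031025003, 28327156050, 308031010026, 328030028012, 34345054014, 34346015059, 33032044545,
  37363063006, 37364008071, 36035048004, 40383018067, 40384075020, 39038016052, 43354023055,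
  43355060024, 42041548044, 62057043034, 47373011064, 47374072013, 46045009048, 74066047037,
  51393068027, 51394029076, 50049052025, 78070040051, 557089058079, 57085140032, 57095041141,
  57094084061, 56055044054, 569113099053, 62107033146, 62121147042, 62120056106, 61060059044,
  66082130035, 66092045131, 66091081073, 65064048063, 70087038152, 70097153049, 70096077086,
  69068067052, 74102036135, 74116136046, 74115065101, 73072071048, 78109158039, 78123050159,
  78122108069, 77076052075, 80083053104, 79161332555, 82083105065, 81162063365, 163081093079,
  85088111056, 84171054347, 87088069112, 86172385067, 173086084098, 90093118053, 89181556338,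
  92093065119, 91182375064, 183091089083, 95098056125, 94201356055, 97098126069, 96202068395,
  203096088094, 100103104058, 99166567333, 102103073105, 101167366071, 168101099117, 334105079099,
  367104101081, 107110061111, 106176348059, 109110112077, 108177075386, 178108124106, 349112106084,
  387111086108, 114117058118, 113191339568, 116117119073, 115192072376, 193115103113, 340119113089,
  377118091115, 121124125061, 120211060357, 123124077126, 122212396076, 213122120110, 358126094120,
  397125122096, 129253006130, 129273131011, 154128127000, 131165127063, 130185064128, 134263135008,
  134283013136, 160133002132, 136170071132, 135195133072, 139222014140, 139238141023, 142138137543,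
  141174137054, 140204055138, 240224560139, 145230146015, 145246024147, 148144544143, 147179059143,
  146214144060, 248232145572, 151254152018, 151274027153, 154150001149, 153175067149, 152205150068,
  276256151129, 157264020158, 157284159029, 160156155003, 159180155075, 158215076156, 286266134157,
  163403080164, 163404165082, 162161083186, 188226161561, 190258130162, 168433169100, 168434102170,
  167166196103, 198234573166, 200268167135, 173463174085, 173464087175, 172171206088, 208228140171,
  210260172152, 178503107179, 178504180109, 177176110216, 218236176146, 220270158177, 183418184090,
  183419092185, 182181186093, 188242562181, 190278182131, 190188163183, 188189225241, 187186184164,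
  190187277257, 189186165185, 193448114194, 193449195116, 192191117196, 198250191574, 200288136192,
  200198193168, 198199249233, 197196169194, 200197267287, 199196195170, 203483095204, 203484205097,
  202201098206, 208244201141, 210280153202, 210208203173, 208209243227, 207206174204, 210207259279,
  209206205175, 213523214121, 213524123215, 212211216124, 218252147211, 220290212159, 220218178213,
  218219235251, 217216214179, 220217289269, 219216180215, 224226558294, 224228295137, 224227239225,
  223222221142, 226261223187, 225405164221, 228262207223, 227465222174, 232234312570, 232236143313,
  232235233247, 231230148229, 234271197231, 233435229169, 236272231217, 235505179230, 240242299559,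
  240244138300, 240243241223, 239238142237, 242281187239, 241420237184, 244282239207, 243485204238,
  248250571317, 248252318144, 248251231249, 247246245148, 250291247197, 249450194245, 252292217247,
  251525246214, 256258304127, 256260149305, 256259257275, 255254154253, 258261189255, 257406253165,
  260262255209, 259466175254, 407262225257, 467261259227, 266268132323, 266270324155, 266269285267,
  265264263160, 268271265199, 267436170263, 270272219265, 269506264180, 437272267233, 507271235269,
  276278128309, 276280310150, 276279255277, 275274273154, 278281275189, 277421185273, 280282209275,
  279486274205, 422282277241, 487281243279, 286288329133, 286290156330, 286289287265, 285284160283,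
  288291199285, 287451283195, 290292285219, 289526215284, 452292249287, 527291289251, 581350014295,
  295408221580, 294468293222, 298341553299, 298359300023, 319297296551, 300423296237, 299488238297,
  303368006304, 303388305018, 325302301021, 305409301253, 304469254302, 308378309011, 308398027310,
  331307030306, 310424273306, 309489307274, 583351313015, 313438582229, 312508230311, 316342317565,
  316360024318, 319315552314, 318453245314, 317528315246, 362344316298, 322369323008, 322389020324,
  325321022320, 324439263320, 323509321264, 391371322303, 328379013329, 328399330029, 331327326031,
  330454326283, 329529284327, 401381308328, 334410585080, 334440100586, 372333104332, 589441352411,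
  337338554341, 336339342566, 340425090336, 340455337114, 382339338118, 344427336296, 344457314337,
  344456426361, 343342319341, 346347032350, 345348351033, 349470085345, 349510346107, 392348347111,
  353472345293, 353512311346, 353511471335, 352351584350, 355356359041, 354357042360, 358490354095,
  358530121355, 402357125356, 362492297354, 362532355315, 362531343491, 361360359319, 364365035368,
  363366369036, 367413082363, 367443364102, 372366365105, 371415363301, 371445320364, 371444414390,
  370369325368, 447417334367, 374375378045, 373376046379, 377428373092, 377458116374, 382376119375,
  381430306373, 381460374326, 381459400429, 380379378331, 462432377340, 384385388038, 383386039389,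
  387473383087, 387513109384, 392386112385, 391475302383, 391515384321, 391514370474, 390389388325,
  517477387349, 394395049398, 393396399050, 397493097393, 397533394123, 402396395126, 401495393307,
  401535327394, 401534494380, 400399331398, 537497358397, 404405410161, 403406162413, 407408403226,
  407409258404, 478406261405, 480412405294, 482415304406, 417412332403, 412416335479, 411410408587,
  417415404365, 415416481370, 414413368409, 417414446411, 416413410372, 419420181425, 418421428182,
  422423242418, 422424419278, 498421420281, 500427299420, 502430421309, 432427418338, 427431499343,
  426425341423, 432430375419, 430431380501, 429428424378, 432429426461, 431428382425, 434435166440,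
  433436443167, 437438234433, 437439434268, 518436435271, 520442312435, 522445436323, 447442433333,
  442446519335, 441440588438, 447445366434, 445446370521, 444443439369, 447444441416, 446443372440,
  449450455191, 448451192458, 452453448250, 452454288449, 538451291450, 540457450317, 542460329451,
  462457339448, 457461343539, 456455453342, 462460449376, 460461541380, 459458379454, 462459431456,
  461458455382, 464465171470, 463466473172, 467468228463, 467469464260, 478466465262, 480472295465,
  482475466305, 477472463347, 472476479352, 471470350468, 477475385464, 475476390481, 474473469388,
  477474471516, 476473392470, 482480407467, 480481411471, 479478468408, 482479474414, 481478409469,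
  484485490201, 483486202493, 487488483244, 487489280484, 498486282485, 500492485300, 502495310486,
  497492356483, 492496361499, 491490488359, 497495484395, 495496501400, 494493398489, 497494536491,
  496493490402, 502500487422, 500501491426, 499498423488, 502499429494, 501498489424, 504505510176,
  503506177513, 507508503236, 507509270504, 518506272505, 520512505313, 522515324506, 517512348503,
  512516352519, 511510508351, 517515504386, 515516521390, 514513389509, 517514476511, 516513510392,
  522520507437, 520521511441, 519518438508, 522519444514, 521518509439, 524525211530, 523526533212,
  527528252523, 527529524290, 538526525292, 540532318525, 542535526330, 537532523357, 532536539361,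
  531530360528, 537535396524, 535536400541, 534533529399, 537534531496, 536533402530, 542540452527,
  540541456531, 539538528453, 542539534459, 541538454529, 563549546139, 575550547145, 547546548034,
  590545543014, 591545544015, 550549545043, 551548543023, 552548544024, 552549564298, 551550576316,
  564554559296, 577556553336, 557561593080, 557562554090, 556555578053, 560561592221, 560562553237,
  559558563142, 562558555164, 561559556184, 564594560543, 579563553551, 576566571314, 577568565337,
  569573596100, 569574566114, 568567578058, 572573595229, 572574565245, 571570575148, 574570567169,
  573571568194, 576597572544, 579575565552, 578579566554, 577598569557, 599577576564, 581587592294,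
  584580590293, 583588595312, 584582591311, 589583581353, 586587593332, 585588596333, 589585580412,
  589586582442, 588587584335, 591594581546, 590597583547, 594593580558, 598592585555, 599592590563,
  597596582570, 598595586567, 599595591575, 599596593578, 598597594579]

/-- A symmetry of the 600-cell, as a permutation of the vertices. -/
@[irreducible]
def symCode₁ : ℕ := pack 1000 [
  64, 15, 14, 39, 40, 88, 87, 90, 56, 25, 37, 72, 7, 61, 5, 6, 66, 22, 71, 42, 118, 55, 85, 1, 51,
  12, 44, 2, 110, 18, 46, 53, 100, 107, 58, 49, 11, 60, 103, 54, 57, 104, 67, 77, 86, 47, 52, 98,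
  93, 59, 48, 89, 109, 28, 33, 65, 62, 32, 117, 114, 80, 41, 101, 75, 68, 106, 38, 79, 95, 24, 50,
  119, 43, 45, 26, 96, 16, 29, 0, 102, 105, 116, 36, 13, 34, 9, 99, 27, 23, 92, 20, 31, 74, 115, 8,
  81, 78, 21, 108, 69, 3, 97, 10, 83, 76, 19, 94, 4, 70, 111, 84, 35, 30, 91, 112, 73, 63, 113, 17,
  82]

/-- Another symmetry of the 600-cell, as a permutation of the vertices. -/
@[irreducible]
def symCode₂ : ℕ := pack 1000 [
  9, 60, 67, 90, 85, 38, 41, 62, 68, 6, 17, 54, 119, 87, 27, 23, 88, 43, 57, 12, 5, 75, 65, 84, 99,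
  53, 92, 91, 45, 105, 72, 81, 40, 39, 78, 71, 102, 29, 26, 112, 111, 24, 36, 61, 1, 115, 7, 49,
  46, 22, 108, 2, 56, 107, 64, 83, 76, 63, 100, 55, 52, 103, 8, 51, 44, 21, 104, 59, 16, 77, 3, 96,
  95, 4, 82, 13, 80, 11, 113, 73, 70, 110, 18, 79, 109, 69, 34, 89, 86, 31, 74, 114, 101, 0, 33,
  10, 19, 32, 116, 106, 48, 37, 97, 28, 117, 94, 42, 47, 15, 30, 118, 98, 93, 25, 35, 14, 20, 50,
  58, 66]

/-- The action of `symCode₁` on the tetrahedra. -/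
@[irreducible]
def tetSymCode₁ : ℕ := pack 1000 [
  101, 102, 333, 440, 104, 105, 81, 334, 332, 99, 103, 117, 100, 567, 68, 88, 443, 366, 364, 447,
  446, 367, 372, 396, 120, 434, 167, 170, 433, 435, 168, 166, 70, 86, 69, 83, 80, 79, 369, 444,
  445, 123, 124, 122, 77, 113, 569, 58, 53, 268, 437, 436, 439, 423, 52, 76, 75, 78, 299, 112, 110,
  109, 108, 93, 118, 90, 89, 320, 263, 324, 323, 555, 578, 556, 557, 521, 518, 509, 522, 420, 422,
  181, 183, 418, 39, 40, 321, 322, 20, 427, 426, 338, 340, 425, 158, 159, 264, 266, 155, 237, 240,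
  562, 561, 559, 242, 184, 386, 387, 515, 514, 513, 384, 389, 296, 298, 554, 577, 553, 341, 336,
  177, 178, 506, 507, 504, 180, 270, 65, 115, 73, 91, 119, 585, 596, 586, 593, 598, 49, 394, 393,
  51, 50, 398, 84, 61, 56, 111, 106, 57, 36, 135, 71, 8, 132, 74, 441, 438, 442, 519, 520, 588,
  421, 182, 419, 424, 92, 142, 558, 560, 139, 592, 16, 22, 19, 25, 7, 392, 516, 517, 349, 511, 431,
  382, 432, 429, 377, 428, 378, 430, 373, 375, 551, 579, 564, 549, 599, 563, 546, 543, 590, 594,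
  156, 160, 157, 29, 134, 3, 31, 28, 12, 2, 176, 505, 503, 107, 508, 510, 346, 348, 351, 512, 310,
  27, 308, 307, 306, 309, 30, 26, 140, 85, 32, 54, 14, 137, 345, 347, 400, 399, 331, 401, 381, 380,
  328, 327, 43, 62, 34, 44, 545, 548, 33, 59, 66, 37, 47, 48, 45, 64, 9, 4, 11, 10, 587, 335, 584,
  589, 581, 580, 353, 352, 293, 350, 116, 136, 46, 72, 374, 376, 13, 133, 379, 326, 595, 312, 583,
  582, 591, 597, 311, 313, 547, 15, 153, 274, 150, 536, 533, 537, 534, 535, 82, 363, 365, 63, 35,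
  193, 200, 196, 192, 195, 173, 174, 171, 355, 121, 357, 42, 60, 530, 410, 416, 417, 412, 411, 413,
  573, 234, 169, 570, 229, 198, 281, 239, 241, 259, 361, 362, 343, 319, 344, 531, 360, 528, 532,
  67, 87, 38, 385, 383, 152, 172, 260, 175, 212, 213, 215, 216, 220, 524, 211, 525, 523, 163, 161,
  186, 164, 188, 162, 403, 406, 404, 187, 114, 568, 339, 566, 337, 191, 574, 250, 194, 342, 371,
  370, 325, 390, 391, 368, 414, 409, 415, 388, 267, 271, 265, 272, 269, 199, 233, 249, 197, 219,
  278, 185, 273, 131, 128, 276, 130, 277, 255, 275, 190, 258, 165, 257, 189, 461, 462, 459, 458,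
  460, 541, 449, 456, 540, 539, 455, 450, 448, 453, 457, 224, 221, 222, 294, 295, 228, 408, 223,
  262, 227, 226, 407, 405, 261, 225, 552, 576, 550, 575, 544, 24, 572, 316, 318, 315, 565, 245,
  571, 317, 314, 17, 21, 1, 5, 0, 151, 6, 18, 254, 149, 303, 304, 301, 305, 302, 129, 256, 154,
  253, 127, 284, 286, 330, 283, 329, 529, 288, 290, 527, 526, 285, 291, 287, 292, 289, 454, 538,
  542, 452, 451, 477, 476, 470, 471, 472, 463, 479, 473, 466, 464, 474, 482, 481, 469, 475, 468,
  467, 465, 478, 480, 179, 236, 146, 230, 143, 147, 232, 218, 252, 214, 235, 247, 231, 251, 217,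
  145, 246, 144, 248, 148, 395, 94, 96, 97, 98, 126, 397, 125, 402, 358, 496, 491, 498, 499, 500,
  489, 494, 495, 502, 501, 493, 497, 354, 359, 238, 297, 300, 141, 41, 55, 138, 23, 95, 356, 492,
  488, 490, 280, 205, 208, 206, 210, 282, 243, 279, 207, 209, 202, 203, 486, 487, 484, 204, 244,
  201, 485, 483]

/-- The action of `symCode₂` on the tetrahedra. -/
@[irreducible]
def tetSymCode₂ : ℕ := pack 1000 [
  228, 174, 350, 345, 295, 222, 224, 293, 581, 468, 465, 467, 472, 471, 459, 452, 54, 140, 141, 32,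
  34, 137, 14, 328, 286, 85, 171, 173, 347, 349, 463, 470, 541, 538, 542, 221, 580, 294, 55, 44,
  57, 327, 284, 330, 529, 478, 479, 480, 408, 88, 111, 84, 56, 81, 534, 399, 533, 535, 105, 527,
  290, 524, 526, 226, 407, 403, 405, 95, 98, 125, 94, 587, 411, 410, 412, 62, 106, 120, 61, 83, 93,
  161, 164, 163, 537, 536, 358, 356, 402, 82, 63, 404, 406, 162, 396, 394, 126, 96, 397, 104, 99,
  332, 585, 334, 79, 80, 523, 525, 121, 60, 211, 530, 357, 367, 366, 417, 416, 372, 365, 413, 212,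
  215, 124, 110, 213, 123, 122, 223, 262, 227, 225, 261, 584, 352, 353, 589, 335, 380, 331, 381,
  400, 401, 378, 291, 285, 287, 292, 289, 199, 204, 206, 208, 201, 203, 207, 33, 348, 346, 59, 107,
  351, 183, 188, 186, 182, 187, 100, 586, 333, 166, 588, 496, 490, 497, 494, 483, 252, 147, 214,
  251, 146, 130, 258, 165, 131, 257, 190, 278, 185, 277, 189, 443, 446, 447, 434, 441, 440, 435,
  433, 438, 442, 393, 97, 395, 398, 202, 493, 489, 495, 486, 484, 220, 178, 216, 219, 176, 218,
  235, 217, 236, 179, 428, 429, 424, 430, 421, 419, 502, 501, 198, 249, 233, 197, 234, 169, 231,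
  247, 11, 308, 309, 306, 273, 128, 310, 307, 268, 265, 271, 267, 437, 436, 272, 269, 239, 244,
  282, 243, 281, 241, 487, 485, 422, 498, 583, 15, 313, 311, 312, 582, 230, 143, 229, 232, 259,
  210, 279, 209, 275, 255, 280, 205, 276, 274, 511, 510, 508, 512, 520, 519, 505, 503, 518, 507,
  461, 432, 431, 9, 31, 12, 10, 30, 142, 138, 139, 240, 238, 466, 172, 464, 260, 175, 450, 194,
  250, 132, 160, 134, 263, 266, 2, 590, 545, 546, 591, 547, 543, 476, 392, 477, 516, 517, 473, 89,
  58, 53, 337, 37, 36, 35, 364, 363, 4, 8, 22, 7, 539, 540, 531, 528, 532, 456, 453, 342, 457, 29,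
  156, 50, 159, 76, 28, 157, 19, 3, 558, 592, 561, 593, 555, 560, 594, 564, 563, 557, 482, 481,
  409, 414, 415, 469, 474, 388, 475, 368, 41, 43, 354, 42, 355, 23, 548, 551, 549, 360, 86, 112,
  69, 108, 77, 87, 387, 383, 385, 78, 181, 184, 418, 242, 420, 425, 237, 90, 336, 338, 562, 553,
  559, 554, 556, 127, 253, 129, 256, 154, 0, 254, 6, 21, 5, 304, 302, 305, 303, 301, 567, 596, 573,
  595, 570, 574, 597, 569, 566, 568, 598, 579, 599, 577, 578, 445, 444, 439, 521, 522, 323, 514,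
  369, 322, 320, 370, 391, 390, 325, 371, 491, 492, 499, 488, 500, 426, 300, 361, 344, 343, 359,
  298, 297, 319, 362, 423, 341, 427, 296, 299, 49, 68, 27, 153, 150, 26, 152, 51, 16, 25, 70, 38,
  67, 40, 52, 151, 17, 1, 18, 149, 246, 144, 248, 145, 148, 245, 544, 318, 314, 317, 24, 552, 550,
  316, 315, 572, 565, 571, 576, 575, 180, 177, 270, 504, 506, 264, 513, 158, 20, 155, 109, 384,
  386, 39, 75, 509, 321, 324, 389, 515, 379, 288, 454, 460, 451, 329, 326, 283, 13, 133, 47, 48,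
  91, 66, 65, 375, 45, 373, 92, 64, 374, 46, 135, 71, 103, 102, 101, 196, 170, 200, 168, 167, 195,
  136, 74, 73, 72, 382, 462, 191, 448, 455, 118, 113, 340, 114, 339, 458, 449, 377, 119, 376, 193,
  117, 192, 115, 116]

/-- A spanning tree of the tetrahedra rooted at the last one: an entry is `1000 * depth + parent`,
where one of the two symmetries takes the parent to the tetrahedron. -/
@[irreducible]
def parentCode : ℕ := pack (1000 ^ 2) [
  7423, 6500, 8319, 10206, 9260, 9427, 7425, 9175, 7342, 7296, 11262, 7261, 7209, 7279, 8022, 9264,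
  5491, 10463, 10501, 8173, 4088, 8426, 7343, 7574, 8453, 4492, 9228, 9485, 6208, 11204, 8227,
  10207, 9019, 8251, 5020, 6338, 10149, 9254, 6494, 7536, 6085, 10571, 10386, 9384, 8039, 4257,
  6275, 9255, 4554, 2483, 10141, 9490, 7054, 5048, 6016, 7038, 8052, 7040, 10047, 10158, 5318,
  6078, 9246, 7090, 10258, 5557, 9556, 7495, 9014, 6034, 10032, 10151, 6276, 7129, 3577, 9056,
  8055, 7397, 5402, 10037, 11036, 6053, 10089, 7035, 7143, 5025, 8393, 10346, 3049, 9332, 6065,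
  8555, 8561, 8063, 10544, 8067, 8545, 8202, 8547, 8009, 8012, 8000, 7001, 9567, 9099, 10005, 9076,
  10159, 9396, 7061, 6060, 10146, 10394, 5045, 9373, 8598, 1599, 7596, 9585, 11131, 8077, 10108,
  10043, 8125, 11042, 7069, 9096, 9418, 10407, 6478, 8181, 10406, 9153, 6280, 7205, 10150, 11274,
  9021, 8573, 6303, 10229, 9570, 10301, 6527, 6504, 7506, 9180, 8177, 7542, 9472, 9295, 9468,
  10350, 8486, 8422, 9098, 11201, 8360, 9530, 9095, 8202, 7081, 7368, 8083, 11082, 9183, 10169,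
  7574, 8573, 9328, 10027, 8313, 7351, 7311, 4312, 8310, 8211, 7524, 10212, 9220, 8125, 7081, 8162,
  8161, 10404, 8188, 7365, 9372, 7367, 9190, 8186, 5582, 9309, 10306, 4312, 8310, 9570, 10232,
  10229, 8148, 9307, 10597, 7205, 9153, 10149, 6280, 9583, 9154, 5582, 6276, 11274, 7110, 9120,
  11355, 10532, 11121, 11357, 9537, 9530, 5402, 8211, 6434, 10005, 10127, 8006, 9130, 7443, 7129,
  8000, 9271, 5526, 9535, 9272, 9399, 9327, 10217, 6219, 9099, 8305, 10253, 8304, 10258, 10104,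
  9256, 7596, 9508, 8503, 7236, 8541, 6230, 8313, 7536, 9176, 9419, 8471, 8278, 8479, 3416, 9182,
  10273, 8352, 6446, 10441, 10068, 8528, 9246, 5318, 8393, 3049, 7397, 10126, 8247, 8251, 9405,
  10282, 5412, 5281, 9410, 7403, 6275, 5580, 4257, 9255, 8486, 2483, 7144, 9024, 7495, 10489, 9147,
  6060, 6494, 10146, 9271, 10037, 8437, 6113, 9475, 7474, 10482, 8569, 9475, 9477, 5473, 7474,
  7476, 9240, 8244, 9238, 8226, 7221, 6266, 3284, 7290, 10462, 10457, 9455, 10461, 4510, 7476,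
  8067, 9086, 8456, 8453, 7069, 10461, 6549, 8244, 8023, 10548, 9485, 9138, 8008, 9002, 10007,
  9264, 8411, 10335, 5412, 7589, 9092, 8479, 6382, 6338, 8471, 11003, 9157, 7028, 10218, 10179,
  9002, 6219, 7133, 8134, 11385, 10387, 11087, 10316, 9086, 5473, 7342, 9336, 9477, 10302, 8339,
  6303, 10114, 6113, 6382, 7038, 9384, 10462, 8022, 8560, 10277, 9190, 8278, 9185, 10187, 5281,
  10137, 7139, 5580, 11349, 8534, 10401, 9535, 9399, 10392, 8541, 9460, 10387, 9176, 7139, 9095,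
  10203, 8023, 6549, 11142, 8055, 10237, 9240, 4088, 6065, 9091, 8445, 9092, 9444, 5048, 10375,
  8073, 7072, 4074, 11325, 9376, 10377, 2116, 9115, 8083, 8226, 10407, 8161, 7261, 6053, 11223,
  6408, 7090, 8480, 7221, 11184, 8188, 8181, 9183, 7028, 5025, 11197, 9250, 7249, 9199, 8052,
  10196, 9195, 9157, 6016, 8039, 7040, 5020, 9019, 9430, 9591, 7311, 8547, 10015, 7351, 8545, 8428,
  7425, 9353, 9421, 9014, 8422, 9418, 9419, 9030, 10308, 9520, 10306, 8011, 8009, 9516, 11031,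
  7506, 8012, 4510, 6379, 8381, 6504, 8503, 5045, 7046, 7522, 8515, 9373, 1599, 9594, 8598, 7209,
  11259, 8578, 9558, 8172, 4554, 3577, 10206, 5174, 6208, 9171, 8173, 8555, 9556, 5557, 9228, 8227,
  7290, 5526, 10212, 6527, 9123, 8285, 8077, 3284, 9180, 9220, 7110, 8109, 7542, 8177, 10330, 7291,
  10158, 8287, 9451, 6078, 10106, 6359, 10361, 4492, 5491, 7343, 9044, 8319, 8347, 9344, 9056,
  7054, 8057, 6085, 8084, 9033, 9427, 8426, 7423, 6034, 11198, 9509, 7249, 9322, 7291, 9250, 5194,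
  8450, 6191, 9514, 8117, 3416, 7367, 8073, 4074, 8167, 10103, 7368, 7365, 9101, 10196, 10370,
  10458, 9376, 8013, 10442, 7046, 8437, 9460, 8518, 7326, 6379, 7522, 10449, 2116, 7072, 9444,
  4268, 8008, 4268, 8285, 10132, 8102, 8134, 11071, 9160, 6266, 9199, 8287, 9364, 11135, 8369,
  9283, 6434, 9439, 7443, 599]

/-- For each but the last of the tetrahedra meeting the last one, a tetrahedron which is disjoint
from the last one and contains all other vertices of it. -/
@[irreducible]
def coverCode : ℕ := pack 1000 [
  139, 145, 34, 14, 15, 43, 23, 24, 298, 316, 296, 336, 80, 90, 53, 221, 237, 142, 164, 184, 139,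
  296, 314, 337, 100, 114, 58, 229, 245, 148, 169, 194, 145, 314, 336, 53, 296, 294, 293, 312, 311,
  353, 332, 333, 412, 442, 335, 14, 15, 221, 80, 14, 229, 100, 15, 53]

/-! ### Coordinates of the two triangulations -/

/-- The vertices of an acute triangulation of the regular simplex (in units of 600), with three
decimal digits for each coordinate. -/
@[irreducible]
def regularCode : ℕ := pack (1000 ^ 3) [
  51049049, 57043031, 46054057, 41041049, 59059049, 59041059, 44056044, 50000050, 52041048,
  43043069, 49046054, 100050050, 59048048, 57057069, 54051054, 28044028, 46046043, 33054054,
  45050050, 56072028, 54054043, 46067054, 50055050, 51046046, 28056072, 49049051, 54049046,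
  44072072, 51051051, 100, 50045050, 100100100, 55050050, 50050, 48048048, 50100050, 52052048,
  54046049, 100000, 50050045, 50050100, 52048052, 28072056, 49051049, 100000000, 46054067,
  56044044, 50050055, 50050000, 41059059, 52048041, 48052052, 44028028, 41051059, 72056028,
  49059059, 49041041, 46049054, 59051041, 51054054, 57031043, 48048059, 46046033, 43054054,
  69043043, 52052059, 54054033, 46057054, 28028044, 72072044, 46043046, 57054046, 31043057,
  57069057, 46046051, 54054051, 46033046, 67054046, 44044056, 56056056, 41041041, 59059041,
  41048052, 52059052, 43031057, 69057057, 33046046, 54067046, 48041052, 59052052, 43046046,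
  54057046, 56028072, 31057043, 54043054, 46051046, 72044072, 43069043, 57046054, 49054046,
  72028056, 43057031, 54046067, 41059051, 59041051, 48052041, 54046057, 46054049, 54033054,
  41049041, 67046054, 51059041, 51041059, 41052048, 59049059, 48059048]

/-- The vertices of an acute triangulation of the standard simplex (in units of 80), with three
decimal digits for each coordinate. -/
@[irreducible]
def standardCode : ℕ := pack (1000 ^ 3) [
  145149147, 82079137, 183185155, 201093157, 95204151, 166167071, 140136209, 214000000, 157123122,
  262174107, 178156127, 215000, 121158121, 173262107, 149183132, 149000240, 152098165, 220134221,
  167144168, 151241, 107149167, 133221221, 143170168, 143130144, 314218218, 164151150, 129146143,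
  217315218, 148166150, 750000000, 163135137, 750000, 136164134, 375000375, 157137158, 375375,
  135157155, 143147129, 750, 136134164, 374376000, 153158135, 217218315, 149152164, 0, 220221133,
  124127125, 170170139, 215, 205205205, 121122158, 162164162, 125000125, 221166166, 127127,
  166221166, 142085141, 188155157, 90142142, 155189152, 137079081, 195175127, 109072176, 183163183,
  81138079, 172200126, 70110184, 160183183, 240000149, 241150, 166098152, 108168148, 261107173,
  107262174, 182133148, 127179154, 176072109, 70184109, 208137140, 138209135, 169062169, 71168168,
  200121179, 126197173, 236089088, 88237089, 201077202, 78203203, 184126127, 125186124, 176102175,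
  112172171, 241150000, 173107262, 168150108, 148132182, 149241000, 107174262, 149168105,
  127155178, 126127000, 88089236, 202203078, 166166221, 142142088, 127125184, 171171110, 158155188,
  183110070, 157093202, 108179073, 95152203, 202152096, 179121201, 152201098, 126174195]

/-! ### The checks -/

/-- The code of the `i`-th vertex of the 600-cell. -/
def icosian (i : ℕ) : ℕ := digit (8 ^ 8) icosianCode i

/-- Twice the `k`-th coordinate of the vertex with code `w` is `ratPart w k + goldPart w k * φ`. -/
def ratPart (w k : ℕ) : Diff := ⟨digit 8 w (2 * k + 1), 2⟩

/-- The coefficient of `φ` in twice the `k`-th coordinate of the vertex with code `w`. -/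
def goldPart (w k : ℕ) : Diff := ⟨digit 8 w (2 * k), 2⟩

/-- Four times the scalar product of two vertices is `innerRat w v + innerGold w v * φ`. -/
def innerRat (w v : ℕ) : Diff :=
  ratPart w 0 * ratPart v 0 + goldPart w 0 * goldPart v 0 +
  (ratPart w 1 * ratPart v 1 + goldPart w 1 * goldPart v 1) +
  (ratPart w 2 * ratPart v 2 + goldPart w 2 * goldPart v 2) +
  (ratPart w 3 * ratPart v 3 + goldPart w 3 * goldPart v 3)

/-- The coefficient of `φ` in four times the scalar product of two vertices. -/
def innerGold (w v : ℕ) : Diff :=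
  ratPart w 0 * goldPart v 0 + goldPart w 0 * (ratPart v 0 + goldPart v 0) +
  (ratPart w 1 * goldPart v 1 + goldPart w 1 * (ratPart v 1 + goldPart v 1)) +
  (ratPart w 2 * goldPart v 2 + goldPart w 2 * (ratPart v 2 + goldPart v 2)) +
  (ratPart w 3 * goldPart v 3 + goldPart w 3 * (ratPart v 3 + goldPart v 3))

theorem unit_check : (force icosianCode fun c => allBelow 120 fun i =>
    force (digit (8 ^ 8) c i) fun w =>
      (innerRat w w).eq ⟨4, 0⟩ && (innerGold w w).eq ⟨0, 0⟩) = true := by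
  decide +kernel

/-- With 4⟨w, v⟩ = p + qφ the test is q ≤ 2 and p + q ≤ 2. It suffices because p + qφ = (p + q) +
q(φ - 1) ≤ 2 + 2(φ - 1) = 2φ, so that no comparison of irrational numbers is needed. -/
theorem inner_check : (force icosianCode fun c => allBelow 120 fun i =>
    force (digit (8 ^ 8) c i) fun w => allBelow i fun j => force (digit (8 ^ 8) c j) fun v =>
      (innerGold w v).force fun q => q.le ⟨2, 0⟩ && (innerRat w v + q).le ⟨2, 0⟩) = true := by
  decide +kernel

/-- The codes of the coordinates of the points which generate the vertices of the 600-cell. -/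
def baseCode : ℕ → ℕ → ℕ
  | 0, 0 => 34
  | 0, _ => 18
  | 1, _ => 26
  | 2, 0 => 19
  | 2, 1 => 26
  | 2, 2 => 11
  | _, _ => 18

/-- The code of the `k`-th coordinate of the vertex with code `w`. -/
def coordCode (w k : ℕ) : ℕ := digit 64 w k

/-- The even permutations of four elements. -/
def evenPerms : List (ℕ × ℕ × ℕ × ℕ) :=
  [(0, 1, 2, 3), (0, 2, 3, 1), (0, 3, 1, 2), (1, 0, 3, 2), (1, 2, 0, 3), (1, 3, 2, 0),
   (2, 0, 1, 3), (2, 1, 3, 0), (2, 3, 0, 1), (3, 0, 2, 1), (3, 1, 0, 2), (3, 2, 1, 0)]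

/-- The sign of the `k`-th coordinate in the sign pattern `e`, applied to a code. -/
def signed (e k m : ℕ) : ℕ := cond (Nat.beq (digit 2 e k) 0) m (Nat.sub 36 m)

theorem evenPerms_check : ∀ τ : Equiv.Perm (Fin 4), Equiv.Perm.sign τ = 1 →
    ((τ 0 : ℕ), (τ 1 : ℕ), (τ 2 : ℕ), (τ 3 : ℕ)) ∈ evenPerms := by
  decide +kernel

theorem evenPerms_check' : ∀ t ∈ evenPerms, ∃ τ : Equiv.Perm (Fin 4), Equiv.Perm.sign τ = 1 ∧
    t = ((τ 0 : ℕ), (τ 1 : ℕ), (τ 2 : ℕ), (τ 3 : ℕ)) := by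
  decide +kernel

/-- One inclusion of `verts600_eq`: the bits of `e` are the four signs, and every generated point
must occur among the 120. -/
theorem icosian_check : (evenPerms.all fun t => allBelow 3 fun b => allBelow 16 fun e =>
    anyBelow 120 fun i => force (icosian i) fun w =>
      Nat.beq (coordCode w t.1) (signed e 0 (baseCode b 0)) &&
      Nat.beq (coordCode w t.2.1) (signed e 1 (baseCode b 1)) &&
      Nat.beq (coordCode w t.2.2.1) (signed e 2 (baseCode b 2)) &&
      Nat.beq (coordCode w t.2.2.2) (signed e 3 (baseCode b 3))) = true := by
  decide +kernel

/-- The other inclusion. The signs of the four coordinates are independent, so each gets its own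
one-bit pattern `e`. -/
theorem icosian_check' : (allBelow 120 fun i => force (icosian i) fun w =>
    evenPerms.any fun t => anyBelow 3 fun b =>
      (anyBelow 2 fun e => Nat.beq (coordCode w t.1) (signed e 0 (baseCode b 0))) &&
      (anyBelow 2 fun e => Nat.beq (coordCode w t.2.1) (signed e 0 (baseCode b 1))) &&
      (anyBelow 2 fun e => Nat.beq (coordCode w t.2.2.1) (signed e 0 (baseCode b 2))) &&
      (anyBelow 2 fun e => Nat.beq (coordCode w t.2.2.2) (signed e 0 (baseCode b 3)))) = true := by
  decide +kernel

/-! ### Checks of the combinatorics of the 600-cell -/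

/-- The `k`-th vertex of the `n`-th tetrahedron. -/
def tetVertex (n k : ℕ) : ℕ := digit 1000 (digit (1000 ^ 4) tetCode n) k

/-- The number of the tetrahedron across the `k`-th facet of the `n`-th tetrahedron. -/
def nbr (n k : ℕ) : ℕ := digit 1000 (digit (1000 ^ 4) nbrCode n) k

/-- The result of applying `k` to the vertices of the `n`-th tetrahedron. -/
noncomputable def withTet (n : ℕ) (k : ℕ → ℕ → ℕ → ℕ → Bool) : Bool :=
  force (digit (1000 ^ 4) tetCode n) fun c =>
  force (digit 1000 c 0) fun c₀ => force (digit 1000 c 1) fun c₁ =>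
  force (digit 1000 c 2) fun c₂ => force (digit 1000 c 3) fun c₃ => k c₀ c₁ c₂ c₃

@[simp]
theorem withTet_eq (n : ℕ) (k : ℕ → ℕ → ℕ → ℕ → Bool) :
    withTet n k = k (tetVertex n 0) (tetVertex n 1) (tetVertex n 2) (tetVertex n 3) := by
  simp [withTet, tetVertex]

/-- Membership in a set of four numbers. -/
def isOneOf (i a b c d : ℕ) : Bool :=
  cond (Nat.beq i a) true (cond (Nat.beq i b) true (cond (Nat.beq i c) true (Nat.beq i d)))

@[simp]
theorem isOneOf_eq_true {i a b c d : ℕ} :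
    isOneOf i a b c d = true ↔ i = a ∨ i = b ∨ i = c ∨ i = d := by
  simp only [isOneOf, Bool.cond_eq_ite, Nat.beq_eq]
  split_ifs <;> simp_all

/-- The test that the vertices with codes `w` and `v` are adjacent. -/
def isAdj (w v : ℕ) : Bool := (innerRat w v).eq ⟨0, 0⟩ && (innerGold w v).eq ⟨2, 0⟩

theorem tet_check : (allBelow 600 fun n => withTet n fun a b c d =>
    Nat.blt a 120 && Nat.blt b 120 && Nat.blt c 120 && Nat.blt d 120 &&
    !Nat.beq a b && !Nat.beq a c && !Nat.beq a d && !Nat.beq b c && !Nat.beq b d &&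
    !Nat.beq c d &&
    force (icosian a) fun a => force (icosian b) fun b => force (icosian c) fun c =>
    force (icosian d) fun d =>
      isAdj a b && isAdj a c && isAdj a d && isAdj b c && isAdj b d && isAdj c d) = true := by
  decide +kernel

/-- The set `{a, b, c, d}`, encoded as a number. -/
def mask (a b c d : ℕ) : ℕ :=
  Nat.add (Nat.add (Nat.pow 2 a) (Nat.pow 2 b)) (Nat.add (Nat.pow 2 c) (Nat.pow 2 d))

/-- Strictly increasing masks show that the 600 sets are distinct with only 599 comparisons. -/
theorem mask_check : (allBelow 599 fun n => withTet n fun a b c d =>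
    withTet (Nat.succ n) fun a' b' c' d' =>
      Nat.blt (mask a b c d) (mask a' b' c' d')) = true := by
  decide +kernel

theorem disjoint_check : (allBelow 543 fun n => withTet n fun a b c d =>
    Nat.blt a 116 && Nat.blt b 116 && Nat.blt c 116 && Nat.blt d 116) = true := by
  decide +kernel

theorem last_check : (withTet 599 fun a b c d =>
    allBelow 4 fun i => isOneOf (Nat.add 116 i) a b c d) = true := by
  decide +kernel

/-- A face disjoint from tetrahedron 599 may be presented as a face of a tetrahedron that meets it;
this check moves such a face into one of the first 543. -/
theorem cover_check : (allBelow 56 fun i => withTet (Nat.add 543 i) fun a b c d =>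
    force (digit 1000 coverCode i) fun m => Nat.blt m 543 && withTet m fun a' b' c' d' =>
      (Nat.ble 116 a || isOneOf a a' b' c' d') && (Nat.ble 116 b || isOneOf b a' b' c' d') &&
      (Nat.ble 116 c || isOneOf c a' b' c' d') &&
      (Nat.ble 116 d || isOneOf d a' b' c' d')) = true := by
  decide +kernel

/-- The exclusive or says that the neighbour contains a vertex precisely when it is not the `k`-th
one. -/
theorem nbr_check : (allBelow 600 fun n => withTet n fun a b c d =>
    allBelow 4 fun k => force (nbr n k) fun m => Nat.blt m 600 && withTet m fun a' b' c' d' =>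
      (Bool.xor (isOneOf a a' b' c' d') (Nat.beq k 0)) &&
      (Bool.xor (isOneOf b a' b' c' d') (Nat.beq k 1)) &&
      (Bool.xor (isOneOf c a' b' c' d') (Nat.beq k 2)) &&
      (Bool.xor (isOneOf d a' b' c' d') (Nat.beq k 3))) = true := by
  decide +kernel

/-- The test that the permutation of the vertices with code `s` and the permutation of the
tetrahedra with code `t` are compatible, and that the first one is indeed a permutation. -/
noncomputable def isSym (s t : ℕ) : Bool :=
  (allBelow 120 fun i => force (digit 1000 s i) fun x => Nat.blt x 120 &&
    allBelow i fun j => !Nat.beq x (digit 1000 s j)) &&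
  (allBelow 600 fun n => withTet n fun a b c d => force (digit 1000 t n) fun m => Nat.blt m 600 &&
    withTet m fun a' b' c' d' =>
      isOneOf (digit 1000 s a) a' b' c' d' && isOneOf (digit 1000 s b) a' b' c' d' &&
      isOneOf (digit 1000 s c) a' b' c' d' && isOneOf (digit 1000 s d) a' b' c' d')

theorem sym_check₁ : isSym symCode₁ tetSymCode₁ = true := by
  decide +kernel

theorem sym_check₂ : isSym symCode₂ tetSymCode₂ = true := by
  decide +kernel

/-- The strict decrease of depth towards the parent rules out cycles; every chain of parents
therefore ends at 599, the only index without a check. -/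
theorem parent_check : (allBelow 599 fun n => force (digit (1000 ^ 2) parentCode n) fun p =>
    force (digit 1000 p 0) fun m => force (digit 1000 p 1) fun h =>
      Nat.blt m 600 && Nat.blt (digit 1000 (digit (1000 ^ 2) parentCode m) 1) h &&
      (Nat.beq (digit 1000 tetSymCode₁ m) n || Nat.beq (digit 1000 tetSymCode₂ m) n)) = true := by
  decide +kernel

/-! ### Checks of acuteness, of the Delaunay property and of the boundary -/

/-- The `i`-th point of the list with code `P`. -/
def point (P i : ℕ) : DiffVec :=
  ⟨⟨digit 1000 (digit (1000 ^ 3) P i) 2, 0⟩, ⟨digit 1000 (digit (1000 ^ 3) P i) 1, 0⟩,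
    ⟨digit 1000 (digit (1000 ^ 3) P i) 0, 0⟩⟩

/-- The value at `u` of the affine functional with gradient `m.1` and constant term `m.2`. -/
def evalAffine (m : DiffVec × Diff) (u : DiffVec) : Diff := m.1.dot u + m.2

/-- The test that the dihedral angle at `ab` of the tetrahedron `abcd` is acute. -/
noncomputable def isAcuteAt (a b c d : DiffVec) : Bool :=
  (b - a).force fun b => (c - a).force fun c => (d - a).force fun d =>
    (b.dot c * b.dot d).lt (c.dot d * b.dot b)

/-- The test that all dihedral angles of the tetrahedron `abcd` are acute. -/
noncomputable def isAcute (a b c d : DiffVec) : Bool :=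
  isAcuteAt a b c d && isAcuteAt a c b d && isAcuteAt a d b c && isAcuteAt b c a d &&
  isAcuteAt b d a c && isAcuteAt c d a b

/-- The determinant of three vectors. -/
def det (b c d : DiffVec) : Diff := b.dot (c.cross d)

/-- The vector `A` such that `A.dot v = det b c d * v.dot v` for `v = b`, `v = c` and `v = d`. -/
def sphereGrad (b c d : DiffVec) : DiffVec :=
  DiffVec.smul (b.dot b) (c.cross d) + DiffVec.smul (c.dot c) (d.cross b) +
    DiffVec.smul (d.dot d) (b.cross c)

/-- A point together with its number and its squared norm. -/
structure NormedPoint where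
  /-- The number. -/
  idx : ℕ
  /-- The first coordinate. -/
  x : ℕ
  /-- The second coordinate. -/
  y : ℕ
  /-- The third coordinate. -/
  z : ℕ
  /-- The squared norm. -/
  h : ℕ

/-- The `i`-th point of the list with code `P`. -/
def normedPoint (P i : ℕ) : NormedPoint :=
  ⟨i, digit 1000 (digit (1000 ^ 3) P i) 2, digit 1000 (digit (1000 ^ 3) P i) 1,
    digit 1000 (digit (1000 ^ 3) P i) 0,
    Nat.add (Nat.mul (digit 1000 (digit (1000 ^ 3) P i) 2) (digit 1000 (digit (1000 ^ 3) P i) 2))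
      (Nat.add
        (Nat.mul (digit 1000 (digit (1000 ^ 3) P i) 1) (digit 1000 (digit (1000 ^ 3) P i) 1))
        (Nat.mul (digit 1000 (digit (1000 ^ 3) P i) 0) (digit 1000 (digit (1000 ^ 3) P i) 0)))⟩

/-- `k u`, in a form which makes the kernel evaluate `u` first. -/
noncomputable def NormedPoint.force (u : NormedPoint) (k : NormedPoint → Bool) : Bool :=
  AcuteTriangulations.force u.idx fun i => AcuteTriangulations.force u.x fun x =>
  AcuteTriangulations.force u.y fun y => AcuteTriangulations.force u.z fun z =>
  AcuteTriangulations.force u.h fun h => k ⟨i, x, y, z, h⟩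

/-- The result of applying `k` to the list of the first `n` points of the list with code `P`. -/
noncomputable def withPoints (P n : ℕ) (k : List NormedPoint → Bool) : Bool :=
  Nat.rec (fun k => k [])
    (fun i ih k => (normedPoint P i).force fun u => ih fun l => k (u :: l)) n k

/-- The conjunction of the values of `f` on a list. -/
noncomputable def allOf (f : NormedPoint → Bool) (l : List NormedPoint) : Bool :=
  List.rec true (fun u _ ih => cond (f u) ih false) l

/-- The test that `E.dot v < D * v.dot v + F`, unless the number of `v` is `i`, `j`, `k` or `l`. -/
def sphereTest (D F : Diff) (E : DiffVec) (i j k l : ℕ) (v : NormedPoint) : Bool :=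
  cond (Nat.blt
    (Nat.add (Nat.add (Nat.mul E.x.pos v.x) (Nat.add (Nat.mul E.y.pos v.y) (Nat.mul E.z.pos v.z)))
      (Nat.add (Nat.mul D.neg v.h) F.neg))
    (Nat.add (Nat.add (Nat.mul E.x.neg v.x) (Nat.add (Nat.mul E.y.neg v.y) (Nat.mul E.z.neg v.z)))
      (Nat.add (Nat.mul D.pos v.h) F.pos))) true (isOneOf v.idx i j k l)

/-- The test that the circumscribed sphere of the tetrahedron `abcd` contains exactly these four of
the points with code `P` on its surface, and none in its interior. -/
noncomputable def isDelaunay (L : List NormedPoint) (i j k l : ℕ) (a b c d : DiffVec) : Bool :=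
  (b - a).force fun b => (c - a).force fun c => (d - a).force fun d =>
  (det b c d).force fun D => (sphereGrad b c d).force fun A =>
  (A + DiffVec.smul (D + D) a).force fun E => (D * a.dot a + A.dot a).force fun F =>
    Diff.lt ⟨0, 0⟩ D && allOf (sphereTest D F E i j k l) L

/-- The test that the affine functional `m` vanishes at `b`, `c` and `d` and is positive at `a`. -/
def isFacetOf (a b c d : DiffVec) (m : DiffVec × Diff) : Bool :=
  (evalAffine m b).eq ⟨0, 0⟩ && (evalAffine m c).eq ⟨0, 0⟩ && (evalAffine m d).eq ⟨0, 0⟩ &&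
  Diff.lt ⟨0, 0⟩ (evalAffine m a)

/-- The test for an acute Delaunay triangulation, with the points with code `P` as vertices, of the
polytope on which the affine functionals in the list `M` are nonnegative. -/
noncomputable def isGood (P : ℕ) (M : List (DiffVec × Diff)) : Bool :=
  force P fun P =>
  (allBelow 116 fun n => (point P n).force fun v => M.all fun m =>
    Diff.le ⟨0, 0⟩ (evalAffine m v)) &&
  withPoints P 116 fun L => allBelow 543 fun n => withTet n fun i j k l =>
    (point P i).force fun a => (point P j).force fun b =>
    (point P k).force fun c => (point P l).force fun d =>
      isAcute a b c d && isDelaunay L i j k l a b c d &&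
      (Nat.blt (nbr n 0) 543 || M.any (isFacetOf a b c d)) &&
      (Nat.blt (nbr n 1) 543 || M.any (isFacetOf b a c d)) &&
      (Nat.blt (nbr n 2) 543 || M.any (isFacetOf c a b d)) &&
      (Nat.blt (nbr n 3) 543 || M.any (isFacetOf d a b c))

/-- The facets of the regular simplex. -/
def regularFacets : List (DiffVec × Diff) :=
  [(⟨⟨1, 0⟩, ⟨1, 0⟩, ⟨1, 0⟩⟩, ⟨0, 100⟩), (⟨⟨1, 0⟩, ⟨0, 1⟩, ⟨0, 1⟩⟩, ⟨100, 0⟩),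
   (⟨⟨0, 1⟩, ⟨1, 0⟩, ⟨0, 1⟩⟩, ⟨100, 0⟩), (⟨⟨0, 1⟩, ⟨0, 1⟩, ⟨1, 0⟩⟩, ⟨100, 0⟩)]

/-- The facets of the standard simplex. -/
def standardFacets : List (DiffVec × Diff) :=
  [(⟨⟨1, 0⟩, ⟨0, 0⟩, ⟨0, 0⟩⟩, ⟨0, 0⟩), (⟨⟨0, 0⟩, ⟨1, 0⟩, ⟨0, 0⟩⟩, ⟨0, 0⟩),
   (⟨⟨0, 0⟩, ⟨0, 0⟩, ⟨1, 0⟩⟩, ⟨0, 0⟩), (⟨⟨0, 1⟩, ⟨0, 1⟩, ⟨0, 1⟩⟩, ⟨750, 0⟩)]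

/-- The tetrahedra and their neighbours are the same for both solids; only the 116 points and the
four facet functionals change. -/
theorem regular_check : isGood regularCode regularFacets = true := by
  decide +kernel

theorem standard_check : isGood standardCode standardFacets = true := by
  decide +kernel

/-! ### Regular triangulations -/

theorem _root_.AffineMap.map_sum_smul {E ι : Type*} [AddCommGroup E] [Module ℝ E] (f : E →ᵃ[ℝ] ℝ)
    (s : Finset ι) (w : ι → ℝ) (x : ι → E) (hw : ∑ i ∈ s, w i = 1) :
    f (∑ i ∈ s, w i • x i) = ∑ i ∈ s, w i * f (x i) := by
  have h : ∀ v, f v = f.linear v + f 0 := fun v => congrFun f.decomp v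
  rw [h, map_sum]
  simp_rw [h (x _), mul_add, Finset.sum_add_distrib, ← Finset.sum_mul, hw, one_mul, map_smul,
    smul_eq_mul]

/-- A set `𝒯` of simplices in a convex set `P` with the following two properties is a triangulation
of `P`: each facet of one of the simplices lies in another one or in a supporting hyperplane of `P`,
and there is a function `h` on the vertices such that the affine interpolation of `h` on each of the
simplices is smaller than `h` at all other vertices. -/
theorem exists_simplicialComplex_of_regular {E : Type*} [AddCommGroup E] [Module ℝ E]
    [FiniteDimensional ℝ E] [DecidableEq E] {𝒯 : Finset (Finset E)} {P : Set E}
    (h𝒯 : 𝒯.Nonempty) (hcard : ∀ T ∈ 𝒯, T.card = Module.finrank ℝ E + 1)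
    (hind : ∀ T ∈ 𝒯, AffineIndependent ℝ ((↑) : T → E)) (hPc : Convex ℝ P)
    (hP : ∀ T ∈ 𝒯, (T : Set E) ⊆ P) (h : E → ℝ) (l : Finset E → E →ᵃ[ℝ] ℝ)
    (heq : ∀ T ∈ 𝒯, ∀ v ∈ T, l T v = h v)
    (hlt : ∀ T ∈ 𝒯, ∀ T' ∈ 𝒯, ∀ v ∈ T', v ∉ T → l T v < h v)
    (hfacet : ∀ T ∈ 𝒯, ∀ v ∈ T, (∃ T' ∈ 𝒯, T.erase v ⊆ T' ∧ v ∉ T') ∨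
      ∃ m : E →ᵃ[ℝ] ℝ, (∀ x ∈ P, 0 ≤ m x) ∧ (∀ u ∈ T.erase v, m u = 0) ∧ 0 < m v) :
    ∃ K : Geometry.SimplicialComplex ℝ E,
      K.faces = {s | s.Nonempty ∧ ∃ T ∈ 𝒯, s ⊆ T} ∧ K.space = P := by
  -- The difference `l S - l T` is nonnegative at the vertices of `S` and nonpositive at those of
  -- `T`, strictly so at vertices of `T` outside `S`. At a common point it must vanish, so the
  -- vertices of `t` outside `S` have weight zero; what remains happens inside the single simplex
  -- `S`.
  have hinter : ∀ S ∈ 𝒯, ∀ T ∈ 𝒯, ∀ s ⊆ S, ∀ t ⊆ T,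
      convexHull ℝ (s : Set E) ∩ convexHull ℝ (t : Set E) ⊆ convexHull ℝ (s ∩ t : Set E) := by
    rintro S hS T hT s hs t ht x ⟨hxs, hxt⟩
    obtain ⟨w, hw0, hw1, hwx⟩ := Finset.mem_convexHull'.1 hxs
    obtain ⟨w', hw0', hw1', hwx'⟩ := Finset.mem_convexHull'.1 hxt
    have e1 := (l S - l T).map_sum_smul s w id hw1
    have e2 := (l S - l T).map_sum_smul t w' id hw1'
    simp only [id_eq] at e1 e2
    rw [hwx] at e1
    rw [hwx'] at e2
    have p1 : ∀ y ∈ s, 0 ≤ w y * (l S - l T) y := by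
      intro y hy
      refine mul_nonneg (hw0 y hy) ?_
      simp only [AffineMap.coe_sub, Pi.sub_apply, heq S hS y (hs hy)]
      by_cases hyT : y ∈ T
      · rw [heq T hT y hyT, sub_self]
      · exact sub_nonneg.2 (hlt T hT S hS y (hs hy) hyT).le
    have p2 : ∀ y ∈ t, w' y * (l S - l T) y ≤ 0 := by
      intro y hy
      refine mul_nonpos_of_nonneg_of_nonpos (hw0' y hy) ?_
      simp only [AffineMap.coe_sub, Pi.sub_apply, heq T hT y (ht hy)]
      by_cases hyS : y ∈ S
      · rw [heq S hS y hyS, sub_self]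
      · exact sub_nonpos.2 (hlt S hS T hT y (ht hy) hyS).le
    have hz : ∑ y ∈ t, w' y * (l S - l T) y = 0 :=
      le_antisymm (Finset.sum_nonpos p2) (by rw [← e2, e1]; exact Finset.sum_nonneg p1)
    have hz' := (Finset.sum_eq_zero_iff_of_nonpos p2).1 hz
    have hw'S : ∀ y ∈ t, y ∉ S → w' y = 0 := by
      intro y hy hyS
      refine (mul_eq_zero.1 (hz' y hy)).resolve_right ?_
      simp only [AffineMap.coe_sub, Pi.sub_apply, heq T hT y (ht hy)]
      exact (sub_neg.2 (hlt S hS T hT y (ht hy) hyS)).ne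
    have hsub : t ∩ S ⊆ t := Finset.inter_subset_left
    have hxt' : x ∈ convexHull ℝ ((t ∩ S : Finset E) : Set E) := by
      refine Finset.mem_convexHull'.2 ⟨w', fun y hy => hw0' y (hsub hy), ?_, ?_⟩
      · rw [← hw1']
        exact Finset.sum_subset hsub fun y hy hy' =>
          hw'S y hy fun hyS => hy' (Finset.mem_inter.2 ⟨hy, hyS⟩)
      · rw [← hwx']
        refine Finset.sum_subset hsub fun y hy hy' => ?_
        rw [hw'S y hy fun hyS => hy' (Finset.mem_inter.2 ⟨hy, hyS⟩), zero_smul]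
    have := (hind S hS).convexHull_inter hs (t₂ := t ∩ S) Finset.inter_subset_right
    have hx : x ∈ convexHull ℝ ((s : Set E) ∩ ((t ∩ S : Finset E) : Set E)) := by
      rw [this]; exact ⟨hxs, hxt'⟩
    exact convexHull_mono (Set.inter_subset_inter_right _ (by exact_mod_cast hsub)) hx
  refine ⟨{ faces := {s | s.Nonempty ∧ ∃ T ∈ 𝒯, s ⊆ T}
            isRelLowerSet_faces := fun s hs => ⟨hs.1, fun t hts ht =>
              ⟨ht, hs.2.imp fun T hT => ⟨hT.1, hts.trans hT.2⟩⟩⟩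
            indep := fun {s} hs => ?_
            inter_subset_convexHull := fun {s t} hs ht => ?_ }, rfl, ?_⟩
  · obtain ⟨T, hT, hsT⟩ := hs.2
    exact (hind T hT).mono (by exact_mod_cast hsT)
  · obtain ⟨S, hS, hsS⟩ := hs.2
    obtain ⟨T, hT, htT⟩ := ht.2
    exact hinter S hS T hT s hsS t htT
  ext x
  rw [Geometry.SimplicialComplex.mem_space_iff]
  constructor
  · rintro ⟨s, ⟨-, T, hT, hsT⟩, hx⟩
    exact convexHull_min ((Finset.coe_subset.2 hsT).trans (hP T hT)) hPc hx
  intro hx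
  -- The simplex containing `x` is the one whose interpolant is largest at `x`. A negative
  -- barycentric coordinate would allow passing to a neighbour with a larger value, or would put `x`
  -- outside `P`.
  obtain ⟨T, hT, hmax⟩ := 𝒯.exists_max_image (fun T => l T x) h𝒯
  have hTne : T.Nonempty := Finset.card_pos.1 (by rw [hcard T hT]; omega)
  refine ⟨T, ⟨hTne, T, hT, subset_rfl⟩, ?_⟩
  have htop : affineSpan ℝ (Set.range ((↑) : T → E)) = ⊤ := by
    rw [(hind T hT).affineSpan_eq_top_iff_card_eq_finrank_add_one, Fintype.card_coe, hcard T hT]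
  let b : AffineBasis T ℝ E := ⟨(↑), hind T hT, htop⟩
  have hb : Set.range b = (T : Set E) := by
    change Set.range ((↑) : T → E) = _
    simp
  rw [← hb, b.convexHull_eq_nonneg_coord]
  intro i
  -- An affine functional that vanishes on the facet opposite to `i` is a multiple of the
  -- barycentric coordinate of `i`.
  have hexp : ∀ m : E →ᵃ[ℝ] ℝ, (∀ u ∈ T.erase i, m u = 0) → m x = b.coord i x * m i := by
    intro m hm
    have e := m.map_sum_smul Finset.univ (fun j => b.coord j x) b (b.sum_coord_apply_eq_one x)
    rw [b.linear_combination_coord_eq_self] at e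
    rw [e]
    refine Finset.sum_eq_single i (fun j _ hj => ?_) (by simp)
    have hbj : b j = (j : E) := rfl
    rw [hbj, hm j (Finset.mem_erase.2 ⟨fun h => hj (Subtype.ext h), j.2⟩), mul_zero]
  by_contra hneg
  rw [not_le] at hneg
  rcases hfacet T hT i i.2 with ⟨T', hT', hsub, hi⟩ | ⟨m, hm0, hm, hmi⟩
  · have e := hexp (l T' - l T) fun u hu => by
      rw [AffineMap.coe_sub, Pi.sub_apply, heq T' hT' u (hsub hu),
        heq T hT u (Finset.mem_of_mem_erase hu), sub_self]
    have hpos : 0 < b.coord i x * (l T' - l T) i := by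
      refine mul_pos_of_neg_of_neg hneg ?_
      rw [AffineMap.coe_sub, Pi.sub_apply, heq T hT i i.2]
      exact sub_neg.2 (hlt T' hT' T hT i i.2 hi)
    rw [← e, AffineMap.coe_sub, Pi.sub_apply] at hpos
    linarith [hmax T' hT']
  · have := hm0 x hx
    rw [hexp m hm] at this
    exact absurd this (not_le.2 (mul_neg_of_neg_of_pos hneg hmi))

/-! ### Combinatorial equivalence -/

theorem vertexSet_eq_image {ι α : Type*} [DecidableEq α] (𝒯 : Set (Finset ι)) {U : Set ι}
    (hU : U = {i | ∃ t ∈ 𝒯, i ∈ t}) {f : ι → α} {K : PreAbstractSimplicialComplex α}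
    (hK : K.faces = {s | s.Nonempty ∧ ∃ t ∈ 𝒯, s ⊆ t.image f}) : vertexSet K = f '' U := by
  ext v
  simp only [vertexSet, hK, hU, Set.mem_ofPred_eq, Set.mem_image, Finset.singleton_nonempty,
    true_and, Finset.singleton_subset_iff, Finset.mem_image]
  constructor
  · rintro ⟨t, ht, i, hi, rfl⟩
    exact ⟨i, ⟨t, ht, hi⟩, rfl⟩
  · rintro ⟨i, ⟨t, ht, hi⟩, rfl⟩
    exact ⟨t, ht, i, hi, rfl⟩

/-- Injectivity on all of `U`, and not merely on each simplex, allows an inclusion of images to be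
pulled back to the index sets. -/
theorem image_mem_faces_iff {ι α : Type*} [DecidableEq α] (𝒯 : Set (Finset ι)) {U : Set ι}
    (hU : U = {i | ∃ t ∈ 𝒯, i ∈ t}) {f : ι → α} (hf : Set.InjOn f U)
    {K : PreAbstractSimplicialComplex α}
    (hK : K.faces = {s | s.Nonempty ∧ ∃ t ∈ 𝒯, s ⊆ t.image f}) (S : Finset ι)
    (hS : (S : Set ι) ⊆ U) : S.image f ∈ K.faces ↔ S.Nonempty ∧ ∃ t ∈ 𝒯, S ⊆ t := by
  rw [hK]
  refine and_congr Finset.image_nonempty (exists_congr fun t => and_congr_right fun ht => ?_)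
  have htU : (t : Set ι) ⊆ U := fun i hi => hU ▸ ⟨t, ht, hi⟩
  exact ⟨fun h i hi => by
    obtain ⟨j, hj, hij⟩ := Finset.mem_image.1 (h (Finset.mem_image_of_mem f hi))
    rwa [← hf (htU hj) (hS hi) hij], fun h => Finset.image_subset_image h⟩

/-- Two complexes whose maximal simplices are indexed by the same family of sets are combinatorially
equivalent. -/
theorem combinatoriallyEquivalent_of_image {ι α β : Type*} [DecidableEq ι] [DecidableEq α]
    [DecidableEq β] (𝒯 : Set (Finset ι)) {U : Set ι} (hU : U = {i | ∃ t ∈ 𝒯, i ∈ t})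
    {f : ι → α} {g : ι → β} (hf : Set.InjOn f U) (hg : Set.InjOn g U)
    {K : PreAbstractSimplicialComplex α} {L : PreAbstractSimplicialComplex β}
    (hK : K.faces = {s | s.Nonempty ∧ ∃ t ∈ 𝒯, s ⊆ t.image f})
    (hL : L.faces = {s | s.Nonempty ∧ ∃ t ∈ 𝒯, s ⊆ t.image g}) :
    CombinatoriallyEquivalent K L := by
  have hmemK := image_mem_faces_iff 𝒯 hU hf hK
  have hmemL := image_mem_faces_iff 𝒯 hU hg hL
  have hKU := vertexSet_eq_image 𝒯 hU hK
  have hLU := vertexSet_eq_image 𝒯 hU hL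
  -- The bijection is `g ∘ f⁻¹`, passing through the index set `U`.
  let e : vertexSet K ≃ vertexSet L := (Equiv.setCongr hKU).trans
    ((Equiv.Set.imageOfInjOn f U hf).symm.trans
      ((Equiv.Set.imageOfInjOn g U hg).trans (Equiv.setCongr hLU.symm)))
  let r : vertexSet K → ι := fun v => (Equiv.Set.imageOfInjOn f U hf).symm (Equiv.setCongr hKU v)
  have hrU : ∀ v, r v ∈ U := fun v => Subtype.coe_prop _
  have hfr : ∀ v, f (r v) = v := fun v =>
    congrArg Subtype.val ((Equiv.Set.imageOfInjOn f U hf).apply_symm_apply (Equiv.setCongr hKU v))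
  have hgr : ∀ v, g (r v) = e v := fun v => rfl
  refine ⟨e, fun s => ?_⟩
  have h1 : s.map (Function.Embedding.subtype _) = (s.image r).image f := by
    rw [Finset.image_image, Finset.map_eq_image]
    exact Finset.image_congr fun v _ => (hfr v).symm
  have h2 : s.map (e.toEmbedding.trans (Function.Embedding.subtype _)) = (s.image r).image g := by
    rw [Finset.image_image, Finset.map_eq_image]
    exact Finset.image_congr fun v _ => (hgr v).symm
  have hsU : ((s.image r : Finset ι) : Set ι) ⊆ U := by
    intro i hi
    obtain ⟨v, -, rfl⟩ := Finset.mem_image.1 (Finset.mem_coe.1 hi)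
    exact hrU v
  rw [h1, h2, hmemK _ hsU, hmemL _ hsU]

/-! ### Acute angles -/

theorem angle_lt_pi_div_two_of_inner_pos {V : Type*} [NormedAddCommGroup V] [InnerProductSpace ℝ V]
    {x y : V} (h : 0 < inner ℝ x y) : InnerProductGeometry.angle x y < Real.pi / 2 := by
  have hx : x ≠ 0 := by rintro rfl; simp at h
  have hy : y ≠ 0 := by rintro rfl; simp at h
  rw [InnerProductGeometry.angle, Real.arccos_lt_pi_div_two]
  positivity

/-- The components orthogonal to u have inner product ⟨x, y⟩ - ⟨u, x⟩⟨u, y⟩/|u|². The strict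
hypothesis already excludes u = 0, for which both sides vanish. -/
theorem inner_starProjection_orthogonal_pos {V : Type*} [NormedAddCommGroup V]
    [InnerProductSpace ℝ V] {u x y : V}
    (h : inner ℝ u x * inner ℝ u y < inner ℝ x y * inner ℝ u u) :
    0 < inner ℝ ((Submodule.span ℝ {u})ᗮ.starProjection x)
      ((Submodule.span ℝ {u})ᗮ.starProjection y) := by
  have hu : u ≠ 0 := by
    rintro rfl
    simp at h
  have hu' : ‖u‖ ^ 2 ≠ 0 := by positivity
  have hpos : 0 < ‖u‖ ^ 2 := by positivity
  have key : inner ℝ (x - (inner ℝ u x / ‖u‖ ^ 2) • u) (y - (inner ℝ u y / ‖u‖ ^ 2) • u) =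
      (inner ℝ x y * ‖u‖ ^ 2 - inner ℝ u x * inner ℝ u y) / ‖u‖ ^ 2 := by
    simp only [inner_sub_left, inner_sub_right, real_inner_smul_left, real_inner_smul_right,
      real_inner_self_eq_norm_sq, real_inner_comm u x]
    field_simp
    ring
  rw [real_inner_self_eq_norm_sq] at h
  rw [Submodule.starProjection_orthogonal_val, Submodule.starProjection_orthogonal_val,
    Submodule.starProjection_singleton, Submodule.starProjection_singleton]
  simp only [RCLike.ofReal_real_eq_id, id_eq]
  rw [key]
  exact div_pos (sub_pos.2 h) hpos

theorem dihedralAngle_lt_pi_div_two {a b c d : Euc 3}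
    (h : inner ℝ (b - a) (c - a) * inner ℝ (b - a) (d - a) <
      inner ℝ (c - a) (d - a) * inner ℝ (b - a) (b - a)) :
    dihedralAngle a b c d < Real.pi / 2 :=
  angle_lt_pi_div_two_of_inner_pos (inner_starProjection_orthogonal_pos h)

/-! ### The vertices of the 600-cell -/

open Real goldenRatio in
/-- The `i`-th vertex of the 600-cell. -/
noncomputable def vert (i : ℕ) : Euc 4 :=
  WithLp.toLp 2 fun k => ((ratPart (icosian i) k).val + (goldPart (icosian i) k).val * φ) / 2

/-- The coordinate with code `c`. -/
noncomputable def coordVal (c : ℕ) : ℝ :=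
  (((c / 8 : ℕ) : ℝ) - 2 + (((c % 8 : ℕ) : ℝ) - 2) * Real.goldenRatio) / 2

/-- The two octal digits of a coordinate form a single digit in base 64. -/
theorem vert_apply (i : ℕ) (k : Fin 4) : vert i k = coordVal (coordCode (icosian i) k) := by
  have h0 : digit 8 (icosian i) (2 * k) = coordCode (icosian i) k % 8 := by
    change icosian i / 8 ^ (2 * (k : ℕ)) % 8 = icosian i / 64 ^ (k : ℕ) % 64 % 8
    rw [pow_mul, Nat.mod_mod_of_dvd _ (by norm_num), show 8 ^ 2 = 64 from rfl]
  have h1 : digit 8 (icosian i) (2 * k + 1) = coordCode (icosian i) k / 8 := by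
    change icosian i / 8 ^ (2 * (k : ℕ) + 1) % 8 = icosian i / 64 ^ (k : ℕ) % 64 / 8
    rw [pow_succ, pow_mul, ← Nat.div_div_eq_div_mul]
    norm_num
    omega
  change (((ratPart (icosian i) k).val : ℝ) +
    ((goldPart (icosian i) k).val : ℝ) * Real.goldenRatio) / 2 = _
  simp only [ratPart, goldPart, h0, h1, coordVal, Diff.val_mk, Int.cast_sub, Int.cast_natCast,
    Nat.cast_ofNat, Int.cast_ofNat]

/-- By φ² = φ + 1, (a + bφ)(c + dφ) = (ac + bd) + (ad + b(c + d))φ; the final combination uses this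
relation once for each product b d. -/
theorem inner_vert (i j : ℕ) : inner ℝ (vert i) (vert j) =
    ((innerRat (icosian i) (icosian j)).val +
      (innerGold (icosian i) (icosian j)).val * Real.goldenRatio) / 4 := by
  rw [PiLp.inner_apply, Fin.sum_univ_four]
  simp only [vert, innerRat, innerGold, Diff.val_add, Diff.val_mul, RCLike.inner_apply,
    conj_trivial, Fin.val_zero, Fin.val_one, Fin.val_two, show ((3 : Fin 4) : ℕ) = 3 from rfl]
  generalize ratPart (icosian i) = a
  generalize ratPart (icosian j) = c
  generalize goldPart (icosian i) = b
  generalize goldPart (icosian j) = d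
  push_cast
  have hφ := Real.goldenRatio_sq
  generalize Real.goldenRatio = φ at *
  linear_combination (((b 0).val * (d 0).val + (b 1).val * (d 1).val + (b 2).val * (d 2).val +
    (b 3).val * (d 3).val : ℝ) / 4) * hφ

theorem goldenRatio_div_two_lt_one : Real.goldenRatio / 2 < 1 := by
  linarith [Real.goldenRatio_lt_two]

theorem inner_vert_self {i : ℕ} (hi : i < 120) : inner ℝ (vert i) (vert i) = (1 : ℝ) := by
  have h := unit_check
  rw [force_eq, allBelow_eq_true] at h
  have h := h i hi
  simp only [force_eq, Bool.and_eq_true, Diff.eq_eq_true] at h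
  change (innerRat (icosian i) (icosian i)).val = _ ∧
    (innerGold (icosian i) (icosian i)).val = _ at h
  rw [inner_vert, h.1, h.2]
  norm_num

theorem inner_vert_le {i j : ℕ} (hi : i < 120) (hj : j < 120) (hij : i ≠ j) :
    inner ℝ (vert i) (vert j) ≤ Real.goldenRatio / 2 := by
  wlog hlt : j < i generalizing i j
  · rw [real_inner_comm]
    exact this hj hi hij.symm (by omega)
  have h := inner_check
  rw [force_eq, allBelow_eq_true] at h
  have h := h i hi
  rw [force_eq, allBelow_eq_true] at h
  have h := h j hlt
  simp only [force_eq, Diff.force_eq, Bool.and_eq_true, Diff.le_eq_true, Diff.val_add] at h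
  change (innerGold (icosian i) (icosian j)).val ≤ _ ∧
    (innerRat (icosian i) (icosian j)).val + (innerGold (icosian i) (icosian j)).val ≤ _ at h
  rw [inner_vert]
  generalize (innerGold (icosian i) (icosian j)).val = q at h
  generalize (innerRat (icosian i) (icosian j)).val = p at h
  simp only [Diff.val_mk] at h
  have h1 : (q : ℝ) ≤ 2 := by exact_mod_cast h.1
  have h2 : (p : ℝ) + q ≤ 2 := by exact_mod_cast h.2
  nlinarith [Real.one_lt_goldenRatio]

theorem vert_injOn : Set.InjOn vert (Set.Iio 120) := by
  intro i hi j hj h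
  by_contra hij
  have h1 := inner_vert_le hi hj hij
  rw [← h, inner_vert_self hi] at h1
  linarith [goldenRatio_div_two_lt_one]

/-- The coordinates of the points generating the vertices of the 600-cell. -/
theorem coordVal_baseCode : ({![1, 0, 0, 0], ![1 / 2, 1 / 2, 1 / 2, 1 / 2],
    ![Real.goldenRatio / 2, 1 / 2, 1 / (2 * Real.goldenRatio), 0]} : Set (Fin 4 → ℝ)) =
    {b | ∃ β < 3, b = fun k : Fin 4 => coordVal (baseCode β k)} := by
  -- The codes express coordinates as integer combinations of 1/2 and φ/2, so 1/φ has to be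
  -- rewritten as φ - 1.
  have hφ : 1 / (2 * Real.goldenRatio) = (Real.goldenRatio - 1) / 2 := by
    have := Real.goldenRatio_ne_zero
    have h := Real.goldenRatio_sq
    generalize Real.goldenRatio = φ at *
    field_simp
    linear_combination -h
  have e0 : (fun k : Fin 4 => coordVal (baseCode 0 k)) = ![1, 0, 0, 0] := by
    ext k; fin_cases k <;> norm_num [coordVal, baseCode]
  have e1 : (fun k : Fin 4 => coordVal (baseCode 1 k)) = ![1 / 2, 1 / 2, 1 / 2, 1 / 2] := by
    ext k; fin_cases k <;> norm_num [coordVal, baseCode]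
  have e2 : (fun k : Fin 4 => coordVal (baseCode 2 k)) =
      ![Real.goldenRatio / 2, 1 / 2, 1 / (2 * Real.goldenRatio), 0] := by
    rw [hφ]
    ext k; fin_cases k <;> (norm_num [coordVal, baseCode]; try ring)
  ext b
  simp only [Set.mem_insert_iff, Set.mem_singleton_iff, Set.mem_ofPred_eq]
  rw [← e0, ← e1, ← e2]
  constructor
  · rintro (rfl | rfl | rfl)
    exacts [⟨0, by norm_num, rfl⟩, ⟨1, by norm_num, rfl⟩, ⟨2, by norm_num, rfl⟩]
  · rintro ⟨β, hβ, rfl⟩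
    interval_cases β <;> simp

/-- Since 36 is octal 44 and the octal digits are at most 4, subtraction from 36 replaces each digit
a by 4 - a without borrowing. With the offset 2, this negates both the rational part and the
coefficient of φ. -/
theorem coordVal_signed {β : ℕ} (hβ : β < 3) (k : Fin 4) (e j : ℕ) (ε : ℤˣ)
    (h : digit 2 e j = 0 ↔ ε = 1) :
    coordVal (signed e j (baseCode β k)) = ((ε : ℤ) : ℝ) * coordVal (baseCode β k) := by
  rcases Int.units_eq_one_or ε with rfl | rfl
  · have : Nat.beq (digit 2 e j) 0 = true := by rw [Nat.beq_eq]; exact h.2 rfl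
    simp [signed, this]
  · have : Nat.beq (digit 2 e j) 0 = false := by
      rw [← Bool.not_eq_true, Nat.beq_eq, h]
      decide
    simp only [signed, this, cond_false]
    interval_cases β <;> fin_cases k <;> norm_num [coordVal, baseCode] <;> ring

theorem digit_bits (b : Fin 4 → ℕ) (hb : ∀ k, b k < 2) (k : Fin 4) :
    digit 2 (b 0 + 2 * b 1 + 4 * b 2 + 8 * b 3) k = b k := by
  have b0 := hb 0
  have b1 := hb 1
  have b2 := hb 2
  have b3 := hb 3
  fin_cases k
  · change (b 0 + 2 * b 1 + 4 * b 2 + 8 * b 3) / 1 % 2 = b 0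
    omega
  · change (b 0 + 2 * b 1 + 4 * b 2 + 8 * b 3) / 2 % 2 = b 1
    omega
  · change (b 0 + 2 * b 1 + 4 * b 2 + 8 * b 3) / 4 % 2 = b 2
    omega
  · change (b 0 + 2 * b 1 + 4 * b 2 + 8 * b 3) / 8 % 2 = b 3
    omega

theorem verts600_eq : verts600 = vert '' Set.Iio 120 := by
  ext x
  simp only [verts600, coordVal_baseCode, Set.mem_ofPred_eq, Set.mem_image, Set.mem_Iio]
  constructor
  · rintro ⟨_, ⟨β, hβ, rfl⟩, τ, hτ, ε, hx⟩
    have h := List.all_eq_true.1 icosian_check _ (evenPerms_check τ hτ)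
    rw [allBelow_eq_true] at h
    have h := h β hβ
    rw [allBelow_eq_true] at h
    -- The sign vector is packed into a number below 16, to match the enumeration in
    -- `icosian_check`.
    let bit : Fin 4 → ℕ := fun k => if ε k = 1 then 0 else 1
    have hbit : ∀ k, bit k < 2 := fun k => by simp only [bit]; split_ifs <;> norm_num
    have hbit' : ∀ k, bit k = 0 ↔ ε k = 1 := fun k => by simp only [bit]; split_ifs <;> simp_all
    have b0 := hbit 0
    have b1 := hbit 1
    have b2 := hbit 2
    have b3 := hbit 3
    have h := h (bit 0 + 2 * bit 1 + 4 * bit 2 + 8 * bit 3) (by omega)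
    rw [anyBelow_eq_true] at h
    obtain ⟨i, hi, h⟩ := h
    simp only [force_eq, Bool.and_eq_true, Nat.beq_eq] at h
    obtain ⟨⟨⟨h0, h1⟩, h2⟩, h3⟩ := h
    have hd : ∀ k : Fin 4,
        digit 2 (bit 0 + 2 * bit 1 + 4 * bit 2 + 8 * bit 3) k = 0 ↔ ε k = 1 := fun k => by
      rw [← hbit' k, digit_bits bit hbit]
    have hk : ∀ k : Fin 4, vert i (τ k) = x (τ k) := by
      intro k
      rw [hx k, vert_apply, ← coordVal_signed hβ k _ k (ε k) (hd k)]
      fin_cases k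
      exacts [congrArg coordVal h0, congrArg coordVal h1, congrArg coordVal h2,
        congrArg coordVal h3]
    refine ⟨i, hi, ?_⟩
    ext j
    rw [← τ.apply_symm_apply j]
    exact hk _
  · rintro ⟨i, hi, rfl⟩
    have h := icosian_check'
    rw [allBelow_eq_true] at h
    have h := h i hi
    rw [force_eq, List.any_eq_true] at h
    obtain ⟨t, ht, h⟩ := h
    rw [anyBelow_eq_true] at h
    obtain ⟨β, hβ, h⟩ := h
    obtain ⟨τ, hτ, rfl⟩ := evenPerms_check' t ht
    simp only [Bool.and_eq_true, anyBelow_eq_true, Nat.beq_eq] at h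
    obtain ⟨⟨⟨h0, h1⟩, h2⟩, h3⟩ := h
    refine ⟨_, ⟨β, hβ, rfl⟩, τ, hτ, ?_⟩
    have hk : ∀ k : Fin 4, ∃ e < 2, coordCode (icosian i) (τ k) = signed e 0 (baseCode β k) := by
      intro k
      fin_cases k
      exacts [h0, h1, h2, h3]
    choose e he hk using hk
    refine ⟨fun k => if e k = 0 then 1 else -1, fun k => ?_⟩
    rw [vert_apply, hk k]
    refine coordVal_signed hβ k _ _ _ ?_
    have := he k
    dsimp only
    generalize e k = e at this
    interval_cases e <;> decide

/-! ### The tetrahedra of the 600-cell -/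

/-- The set of the vertices of the `n`-th tetrahedron. -/
def tetSet (n : ℕ) : Finset ℕ :=
  {tetVertex n 0, tetVertex n 1, tetVertex n 2, tetVertex n 3}

theorem mem_tetSet {n i : ℕ} : i ∈ tetSet n ↔
    i = tetVertex n 0 ∨ i = tetVertex n 1 ∨ i = tetVertex n 2 ∨ i = tetVertex n 3 := by
  simp [tetSet]

theorem lt_of_mem_tetSet {n i : ℕ} (hn : n < 600) (hi : i ∈ tetSet n) : i < 120 := by
  have h := allBelow_eq_true.1 tet_check n hn
  simp only [withTet_eq, Bool.and_eq_true, Nat.blt_eq] at h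
  rw [mem_tetSet] at hi
  rcases hi with rfl | rfl | rfl | rfl <;> tauto

theorem tetSet_subset {n : ℕ} (hn : n < 600) : (tetSet n : Set ℕ) ⊆ Set.Iio 120 :=
  fun _ hi => lt_of_mem_tetSet hn hi

theorem tetVertex_ne {n : ℕ} (hn : n < 600) :
    tetVertex n 0 ≠ tetVertex n 1 ∧ tetVertex n 0 ≠ tetVertex n 2 ∧
    tetVertex n 0 ≠ tetVertex n 3 ∧ tetVertex n 1 ≠ tetVertex n 2 ∧
    tetVertex n 1 ≠ tetVertex n 3 ∧ tetVertex n 2 ≠ tetVertex n 3 := by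
  have h := allBelow_eq_true.1 tet_check n hn
  simp only [withTet_eq, Bool.and_eq_true, Bool.not_eq_true', ← Bool.not_eq_true, Nat.beq_eq] at h
  tauto

theorem card_tetSet {n : ℕ} (hn : n < 600) : (tetSet n).card = 4 := by
  obtain ⟨h1, h2, h3, h4, h5, h6⟩ := tetVertex_ne hn
  rw [tetSet, Finset.card_insert_of_notMem, Finset.card_insert_of_notMem, Finset.card_pair h6] <;>
    simp [*]

theorem inner_vert_of_mem_tetSet {n i j : ℕ} (hn : n < 600) (hi : i ∈ tetSet n)
    (hj : j ∈ tetSet n) (hij : i ≠ j) :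
    inner ℝ (vert i) (vert j) = Real.goldenRatio / 2 := by
  have key : ∀ {i j}, isAdj (icosian i) (icosian j) = true →
      inner ℝ (vert i) (vert j) = Real.goldenRatio / 2 := by
    intro i j h
    simp only [isAdj, Bool.and_eq_true, Diff.eq_eq_true] at h
    rw [inner_vert, h.1, h.2]
    norm_num
    ring
  have h := allBelow_eq_true.1 tet_check n hn
  simp only [withTet_eq, Bool.and_eq_true, force_eq] at h
  obtain ⟨-, ⟨⟨⟨⟨a1, a2⟩, a3⟩, a4⟩, a5⟩, a6⟩ := h
  rw [mem_tetSet] at hi hj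
  rcases hi with rfl | rfl | rfl | rfl <;> rcases hj with rfl | rfl | rfl | rfl <;>
    first
    | exact absurd rfl hij
    | exact key ‹_›
    | (rw [real_inner_comm]; exact key ‹_›)

theorem nbr_spec {n k : ℕ} (hn : n < 600) (hk : k < 4) : nbr n k < 600 ∧
    (tetSet n).erase (tetVertex n k) ⊆ tetSet (nbr n k) ∧ tetVertex n k ∉ tetSet (nbr n k) := by
  have h := allBelow_eq_true.1 nbr_check n hn
  rw [withTet_eq, allBelow_eq_true] at h
  have h := h k hk
  simp only [force_eq, withTet_eq, Bool.and_eq_true, Nat.blt_eq] at h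
  -- Decodes the exclusive or: the vertex in position `j` survives in the neighbour unless `j` is
  -- the position `k` across whose facet one passes.
  have key : ∀ i j, (isOneOf i (tetVertex (nbr n k) 0) (tetVertex (nbr n k) 1)
      (tetVertex (nbr n k) 2) (tetVertex (nbr n k) 3) ^^ Nat.beq k j) = true →
      (i ∈ tetSet (nbr n k) ↔ k ≠ j) := by
    intro i j hi
    rw [mem_tetSet, ← isOneOf_eq_true, Ne, ← Nat.beq_eq]
    revert hi
    cases isOneOf i (tetVertex (nbr n k) 0) (tetVertex (nbr n k) 1)
      (tetVertex (nbr n k) 2) (tetVertex (nbr n k) 3) <;> cases Nat.beq k j <;> simp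
  obtain ⟨hlt, ⟨⟨h0, h1⟩, h2⟩, h3⟩ := h
  have h0 := key _ _ h0
  have h1 := key _ _ h1
  have h2 := key _ _ h2
  have h3 := key _ _ h3
  refine ⟨hlt, ?_, ?_⟩
  · intro i hi
    obtain ⟨hne, hi⟩ := Finset.mem_erase.1 hi
    rw [mem_tetSet] at hi
    rcases hi with rfl | rfl | rfl | rfl
    · exact h0.2 (by rintro rfl; exact hne rfl)
    · exact h1.2 (by rintro rfl; exact hne rfl)
    · exact h2.2 (by rintro rfl; exact hne rfl)
    · exact h3.2 (by rintro rfl; exact hne rfl)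
  · interval_cases k <;> simp_all

theorem exists_tetVertex_eq {n i : ℕ} (hi : i ∈ tetSet n) : ∃ k < 4, i = tetVertex n k := by
  rw [mem_tetSet] at hi
  rcases hi with h | h | h | h
  exacts [⟨0, by norm_num, h⟩, ⟨1, by norm_num, h⟩, ⟨2, by norm_num, h⟩, ⟨3, by norm_num, h⟩]

/-- The Gram matrix of a tetrahedron has 1 on the diagonal and φ/2 elsewhere, so it is (φ/2)J + (1 -
φ/2)I with J the all-ones matrix. -/
theorem inner_vert_sum {n i : ℕ} (hn : n < 600) (hi : i ∈ tetSet n) (g : ℕ → ℝ) :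
    inner ℝ (vert i) (∑ j ∈ tetSet n, g j • vert j) =
      Real.goldenRatio / 2 * ∑ j ∈ tetSet n, g j + (1 - Real.goldenRatio / 2) * g i := by
  rw [inner_sum, ← Finset.add_sum_erase _ _ hi, ← Finset.add_sum_erase (tetSet n) g hi,
    real_inner_smul_right, inner_vert_self (lt_of_mem_tetSet hn hi)]
  have : ∑ j ∈ (tetSet n).erase i, inner ℝ (vert i) (g j • vert j) =
      Real.goldenRatio / 2 * ∑ j ∈ (tetSet n).erase i, g j := by
    rw [Finset.mul_sum]
    refine Finset.sum_congr rfl fun j hj => ?_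
    obtain ⟨hji, hj⟩ := Finset.mem_erase.1 hj
    rw [real_inner_smul_right, inner_vert_of_mem_tetSet hn hi hj hji.symm, mul_comm]
  rw [this]
  ring

/-- The vertices of a tetrahedron of the 600-cell span the whole space. -/
theorem exists_eq_sum_smul_vert {n : ℕ} (hn : n < 600) (y : Euc 4) :
    ∃ g : ℕ → ℝ, y = ∑ j ∈ tetSet n, g j • vert j := by
  have hpos := Real.goldenRatio_pos
  have hlt := goldenRatio_div_two_lt_one
  have hli : LinearIndependent ℝ fun j : tetSet n => vert j := by
    change LinearIndepOn ℝ vert (tetSet n : Set ℕ)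
    rw [linearIndepOn_finset_iff]
    intro g hg
    have h : ∀ i ∈ tetSet n, Real.goldenRatio / 2 * ∑ j ∈ tetSet n, g j +
        (1 - Real.goldenRatio / 2) * g i = 0 := fun i hi => by
      rw [← inner_vert_sum hn hi, hg, inner_zero_right]
    -- Adding the four equations gives 4(φ/2) + (1 - φ/2) = 1 + 3(φ/2) times the sum of the
    -- coefficients.
    have hS : ∑ j ∈ tetSet n, g j = 0 := by
      have h' := Finset.sum_eq_zero h
      rw [Finset.sum_add_distrib, Finset.sum_const, card_tetSet hn, ← Finset.mul_sum] at h'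
      have h'' : (1 + 3 * (Real.goldenRatio / 2)) * ∑ j ∈ tetSet n, g j = 0 := by
        rw [← h', nsmul_eq_mul]
        push_cast
        generalize Real.goldenRatio = φ
        ring
      exact (mul_eq_zero.1 h'').resolve_left (by positivity)
    intro i hi
    have hi := h i hi
    rw [hS, mul_zero, zero_add] at hi
    exact (mul_eq_zero.1 hi).resolve_left (by linarith)
  have hspan := hli.span_eq_top_of_card_eq_finrank' (by
    rw [Fintype.card_coe, card_tetSet hn, finrank_euclideanSpace_fin])
  have hy : y ∈ Submodule.span ℝ (Set.range fun j : tetSet n => vert j) := hspan ▸ trivial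
  obtain ⟨c, hc⟩ := (Submodule.mem_span_range_iff_exists_fun ℝ).1 hy
  refine ⟨fun j => if h : j ∈ tetSet n then c ⟨j, h⟩ else 0, ?_⟩
  rw [← hc, ← Finset.sum_coe_sort (tetSet n)]
  exact Finset.sum_congr rfl fun j _ => by simp

open Classical in
/-- The vertices of a tetrahedron form a face. -/
theorem isProperFaceVertexSet_image_tetSet {n : ℕ} (hn : n < 600) :
    IsProperFaceVertexSet verts600 ((tetSet n).image vert) := by
  have hlt := goldenRatio_div_two_lt_one
  have hin : ∀ i ∈ tetSet n, inner ℝ (∑ j ∈ tetSet n, vert j) (vert i) =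
      1 + 3 * (Real.goldenRatio / 2) := by
    intro i hi
    have h := inner_vert_sum hn hi fun _ => 1
    simp only [one_smul, Finset.sum_const, card_tetSet hn] at h
    rw [real_inner_comm, h]
    generalize Real.goldenRatio = φ
    ring
  -- A vertex outside has inner product at most 4(φ/2) with the sum, which is below 1 + 3(φ/2)
  -- because φ/2 < 1.
  have hout : ∀ i < 120, i ∉ tetSet n → inner ℝ (∑ j ∈ tetSet n, vert j) (vert i) <
      1 + 3 * (Real.goldenRatio / 2) := by
    intro i hi hin
    have h : inner ℝ (∑ j ∈ tetSet n, vert j) (vert i) ≤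
        ∑ j ∈ tetSet n, Real.goldenRatio / 2 := by
      rw [sum_inner]
      exact Finset.sum_le_sum fun j hj => inner_vert_le (lt_of_mem_tetSet hn hj) hi
        (by rintro rfl; exact hin hj)
    rw [Finset.sum_const, card_tetSet hn, nsmul_eq_mul] at h
    push_cast at h
    linarith
  have hne : (tetSet n).Nonempty := Finset.card_pos.1 (by rw [card_tetSet hn]; norm_num)
  refine ⟨hne.image _, innerₛₗ ℝ (∑ j ∈ tetSet n, vert j),
    1 + 3 * (Real.goldenRatio / 2), ?_, ?_, ?_⟩
  · intro h0
    obtain ⟨i, hi⟩ := hne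
    have h := hin i hi
    rw [← innerₛₗ_apply_apply, h0, LinearMap.zero_apply] at h
    have := Real.goldenRatio_pos
    linarith
  · rw [verts600_eq]
    rintro _ ⟨i, hi, rfl⟩
    rw [innerₛₗ_apply_apply]
    by_cases hin' : i ∈ tetSet n
    · exact (hin i hin').le
    · exact (hout i hi hin').le
  · ext v
    simp only [Finset.coe_image, Set.mem_image, Finset.mem_coe, verts600_eq, Set.mem_ofPred_eq,
      innerₛₗ_apply_apply]
    constructor
    · rintro ⟨i, hi, rfl⟩
      exact ⟨⟨i, lt_of_mem_tetSet hn hi, rfl⟩, hin i hi⟩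
    · rintro ⟨⟨i, hi, rfl⟩, h⟩
      refine ⟨i, ?_, rfl⟩
      by_contra hin'
      exact (hout i hi hin').ne h

open Classical in
/-- Each proper face of the 600-cell is contained in one of the tetrahedra. -/
theorem exists_subset_image_tetSet {t : Finset (Euc 4)}
    (ht : IsProperFaceVertexSet verts600 t) : ∃ n < 600, t ⊆ (tetSet n).image vert := by
  obtain ⟨-, l, c, hl0, hlc, ht⟩ := ht
  have hlt := goldenRatio_div_two_lt_one
  let y : Euc 4 := (InnerProductSpace.toDual ℝ (Euc 4)).symm (LinearMap.toContinuousLinearMap l)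
  have hly : ∀ x, l x = inner ℝ y x := fun x => by
    rw [InnerProductSpace.toDual_symm_apply]
    rfl
  -- A tetrahedron with the largest sum of values of `l`; the aim is that `y` lies in the cone over
  -- it.
  obtain ⟨n, hn, hmax⟩ := (Finset.range 600).exists_max_image
    (fun n => ∑ i ∈ tetSet n, l (vert i)) ⟨0, by simp⟩
  rw [Finset.mem_range] at hn
  obtain ⟨g, hg⟩ := exists_eq_sum_smul_vert hn y
  have hl : ∀ i ∈ tetSet n, l (vert i) =
      Real.goldenRatio / 2 * ∑ j ∈ tetSet n, g j + (1 - Real.goldenRatio / 2) * g i := by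
    intro i hi
    rw [hly, hg, real_inner_comm, inner_vert_sum hn hi]
  have hgnn : ∀ i ∈ tetSet n, 0 ≤ g i := by
    intro i hi
    obtain ⟨k, hk, rfl⟩ := exists_tetVertex_eq hi
    obtain ⟨hm, hsub, hnot⟩ := nbr_spec hn hk
    set i := tetVertex n k
    set m := nbr n k
    -- The neighbour across the facet opposite to `i` has a single further vertex `j`. Maximality
    -- gives l(j) ≤ l(i). The three shared vertices have inner product φ/2 with both `i` and `j`, so
    -- only the `g i` terms remain: g i · ⟨i, j⟩ ≤ g i, where ⟨i, j⟩ ≤ φ/2 < 1.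
    have hcard : (tetSet m \ (tetSet n).erase i).card = 1 := by
      rw [Finset.card_sdiff_of_subset hsub, card_tetSet hm, Finset.card_erase_of_mem hi,
        card_tetSet hn]
    obtain ⟨j, hj⟩ := Finset.card_eq_one.1 hcard
    have hj' : j ∈ tetSet m \ (tetSet n).erase i := hj ▸ Finset.mem_singleton_self j
    obtain ⟨hjm, hjn⟩ := Finset.mem_sdiff.1 hj'
    have hji : j ≠ i := by rintro rfl; exact hnot hjm
    have hsum : ∑ a ∈ tetSet m, l (vert a) ≤ ∑ a ∈ tetSet n, l (vert a) :=
      hmax m (Finset.mem_range.2 hm)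
    rw [← Finset.sum_sdiff hsub, hj, Finset.sum_singleton, ← Finset.add_sum_erase _ _ hi,
      add_le_add_iff_right] at hsum
    rw [hly, hly, hg, sum_inner, sum_inner, ← Finset.add_sum_erase _ _ hi,
      ← Finset.add_sum_erase (tetSet n) _ hi] at hsum
    have heq : ∀ a ∈ (tetSet n).erase i, inner ℝ (g a • vert a) (vert j) =
        inner ℝ (g a • vert a) (vert i) := by
      intro a ha
      obtain ⟨hai, han⟩ := Finset.mem_erase.1 ha
      have haj : a ≠ j := by rintro rfl; exact hjn ha
      rw [real_inner_smul_left, real_inner_smul_left, inner_vert_of_mem_tetSet hm (hsub ha) hjm haj,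
        inner_vert_of_mem_tetSet hn han hi hai]
    rw [Finset.sum_congr rfl heq, add_le_add_iff_right, real_inner_smul_left, real_inner_smul_left,
      inner_vert_self (lt_of_mem_tetSet hn hi)] at hsum
    have hle := inner_vert_le (lt_of_mem_tetSet hn hi) (lt_of_mem_tetSet hm hjm) hji.symm
    by_contra hneg
    rw [not_le] at hneg
    nlinarith
  refine ⟨n, hn, fun v hv => ?_⟩
  have hv' : v ∈ {v ∈ verts600 | l v = c} := ht ▸ Finset.mem_coe.2 hv
  obtain ⟨hvV, hvc⟩ := hv'
  rw [verts600_eq] at hvV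
  obtain ⟨m, hm, rfl⟩ := hvV
  refine Finset.mem_image_of_mem _ ?_
  by_contra hmn
  have hle : l (vert m) ≤ Real.goldenRatio / 2 * ∑ j ∈ tetSet n, g j := by
    rw [hly, hg, sum_inner, Finset.mul_sum]
    refine Finset.sum_le_sum fun j hj => ?_
    rw [real_inner_smul_left, mul_comm]
    exact mul_le_mul_of_nonneg_right (inner_vert_le (lt_of_mem_tetSet hn hj) hm
      (by rintro rfl; exact hmn hj)) (hgnn j hj)
  -- If the vertex `m` outside the tetrahedron attained `c`, then `c` would be at most (φ/2)∑g,
  -- while the value at `i` is this bound plus (1 - φ/2) g i. Hence all coefficients vanish, and so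
  -- does `l`.
  have hg0 : ∀ i ∈ tetSet n, g i = 0 := by
    intro i hi
    have h := hlc (vert i) (verts600_eq ▸ ⟨i, lt_of_mem_tetSet hn hi, rfl⟩)
    rw [hl i hi] at h
    have h0 := hgnn i hi
    by_contra hne
    have : 0 < (1 - Real.goldenRatio / 2) * g i :=
      mul_pos (by linarith) (lt_of_le_of_ne h0 (Ne.symm hne))
    linarith
  apply hl0
  ext x
  rw [hly, hg, Finset.sum_eq_zero fun i hi => by rw [hg0 i hi, zero_smul], inner_zero_left,
    LinearMap.zero_apply]

/-! ### Symmetries -/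

open Classical in
/-- A labelling of the vertices of the 600-cell which is compatible with the list of tetrahedra. -/
structure IsLabelling (W : ℕ → Euc 4) : Prop where
  injOn : Set.InjOn W (Set.Iio 120)
  faces_eq : X600.faces = {s | s.Nonempty ∧ ∃ n < 600, s ⊆ (tetSet n).image W}

theorem isLabelling_vert : IsLabelling vert := by
  classical
  refine ⟨vert_injOn, ?_⟩
  ext s
  refine and_congr_right fun _ => ⟨?_, ?_⟩
  · rintro ⟨t, ht, hst⟩
    obtain ⟨n, hn, h⟩ := exists_subset_image_tetSet ht
    exact ⟨n, hn, by convert hst.trans h⟩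
  · rintro ⟨n, hn, h⟩
    exact ⟨_, isProperFaceVertexSet_image_tetSet hn, by convert h⟩

/-- A set of indices is compared through its binary mask ∑ 2^i, which increases strictly along the
list. -/
theorem tetSet_injOn : Set.InjOn tetSet (Set.Iio 600) := by
  have hmask : ∀ n < 600, mask (tetVertex n 0) (tetVertex n 1) (tetVertex n 2) (tetVertex n 3) =
      ∑ i ∈ tetSet n, 2 ^ i := by
    intro n hn
    obtain ⟨h1, h2, h3, h4, h5, h6⟩ := tetVertex_ne hn
    rw [tetSet, Finset.sum_insert (by simp [*]), Finset.sum_insert (by simp [*]),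
      Finset.sum_insert (by simp [*]), Finset.sum_singleton, ← add_assoc, ← add_assoc]
    exact (add_assoc _ _ _).symm
  have hstep : ∀ n, n + 1 < 600 → ∑ i ∈ tetSet n, 2 ^ i < ∑ i ∈ tetSet (n + 1), 2 ^ i := by
    intro n hn
    have h := allBelow_eq_true.1 mask_check n (by omega)
    simp only [withTet_eq, Nat.blt_eq] at h
    rwa [hmask n (by omega), hmask _ (by exact hn)] at h
  have hmono : ∀ n m, n < m → m < 600 → ∑ i ∈ tetSet n, 2 ^ i < ∑ i ∈ tetSet m, 2 ^ i := by
    intro n m hnm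
    induction m, hnm using Nat.le_induction with
    | base => exact hstep n
    | succ m _ ih => exact fun hm => (ih (by omega)).trans (hstep m hm)
  intro n hn m hm h
  by_contra hne
  rcases Nat.lt_or_gt_of_ne hne with hlt | hlt
  · exact (hmono n m hlt hm).ne (by rw [h])
  · exact (hmono m n hlt hn).ne (by rw [h])

theorem isSym_spec {s t : ℕ} (h : isSym s t = true) :
    Set.MapsTo (digit 1000 s) (Set.Iio 120) (Set.Iio 120) ∧
    Set.InjOn (digit 1000 s) (Set.Iio 120) ∧
    ∀ n < 600, digit 1000 t n < 600 ∧
      tetSet (digit 1000 t n) = (tetSet n).image (digit 1000 s) := by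
  simp only [isSym, Bool.and_eq_true, allBelow_eq_true, force_eq, withTet_eq, Nat.blt_eq,
    Bool.not_eq_true', ← Bool.not_eq_true, Nat.beq_eq] at h
  obtain ⟨h1, h2⟩ := h
  have hinj : Set.InjOn (digit 1000 s) (Set.Iio 120) := by
    intro i hi j hj hij
    by_contra hne
    rcases Nat.lt_or_gt_of_ne hne with hlt | hlt
    · exact (h1 j hj).2 i hlt hij.symm
    · exact (h1 i hi).2 j hlt hij
  refine ⟨fun i hi => (h1 i hi).1, hinj, fun n hn => ?_⟩
  obtain ⟨hlt, ⟨⟨h0, h1⟩, h2⟩, h3⟩ := h2 n hn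
  -- Only one inclusion was tested; both sets have four elements.
  refine ⟨hlt, (Finset.eq_of_subset_of_card_le ?_ ?_).symm⟩
  · intro i hi
    obtain ⟨j, hj, rfl⟩ := Finset.mem_image.1 hi
    rw [mem_tetSet, ← isOneOf_eq_true]
    rw [mem_tetSet] at hj
    rcases hj with rfl | rfl | rfl | rfl <;> assumption
  · rw [card_tetSet hlt, Finset.card_image_of_injOn (hinj.mono (tetSet_subset hn)),
      card_tetSet hn]

/-- A symmetry merely permutes the list of tetrahedra. Surjectivity of the induced map of indices is
not tested: it follows from injectivity on a finite set, which is inherited from the map of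
vertices. -/
theorem IsLabelling.comp {W : ℕ → Euc 4} (hW : IsLabelling W) {s t : ℕ} (h : isSym s t = true) :
    IsLabelling (W ∘ digit 1000 s) := by
  classical
  obtain ⟨hmaps, hinj, htet⟩ := isSym_spec h
  refine ⟨hW.injOn.comp hinj hmaps, ?_⟩
  have htmaps : ∀ n ∈ Finset.range 600, digit 1000 t n ∈ Finset.range 600 := fun n hn =>
    Finset.mem_range.2 (htet n (Finset.mem_range.1 hn)).1
  have htinj : Set.InjOn (digit 1000 t) (Finset.range 600 : Set ℕ) := by
    intro n hn m hm hnm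
    have hn := Finset.mem_range.1 (Finset.mem_coe.1 hn)
    have hm := Finset.mem_range.1 (Finset.mem_coe.1 hm)
    have e : (tetSet n).image (digit 1000 s) = (tetSet m).image (digit 1000 s) := by
      rw [← (htet n hn).2, ← (htet m hm).2, hnm]
    apply tetSet_injOn hn hm
    have := (hinj.image_eq_image_iff (tetSet_subset hn) (tetSet_subset hm)).1 (by
      rw [← Finset.coe_image, ← Finset.coe_image, e])
    exact_mod_cast this
  have htsurj := Finset.surjOn_of_injOn_of_card_le _ htmaps htinj le_rfl
  rw [hW.faces_eq]
  ext u
  refine and_congr_right fun _ => ⟨?_, ?_⟩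
  · rintro ⟨m, hm, hu⟩
    obtain ⟨n, hn, rfl⟩ := htsurj (Finset.mem_coe.2 (Finset.mem_range.2 hm))
    have hn := Finset.mem_range.1 (Finset.mem_coe.1 hn)
    refine ⟨n, hn, hu.trans ?_⟩
    rw [(htet n hn).2, Finset.image_image]
  · rintro ⟨n, hn, hu⟩
    refine ⟨_, (htet n hn).1, hu.trans ?_⟩
    rw [(htet n hn).2, Finset.image_image]

/-- Induction on the depth in the spanning tree. If the symmetry s takes the parent m to n, then `W
∘ s` maps tetrahedron m to where `W` maps n, so the labelling found for m and `W ∘ s` also serves n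
and `W`. -/
theorem exists_isLabelling (h n : ℕ) (hn : n < 600)
    (hh : digit 1000 (digit (1000 ^ 2) parentCode n) 1 ≤ h) (W : ℕ → Euc 4) (hW : IsLabelling W) :
    ∃ W', IsLabelling W' ∧ (tetSet 599).image W' = (tetSet n).image W := by
  induction h generalizing n W with
  | zero =>
    by_cases hn' : n = 599
    · exact ⟨W, hW, by rw [hn']⟩
    have := allBelow_eq_true.1 parent_check n (by omega)
    simp only [force_eq, Bool.and_eq_true, Nat.blt_eq] at this
    omega
  | succ h ih =>
    by_cases hn' : n = 599
    · exact ⟨W, hW, by rw [hn']⟩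
    have := allBelow_eq_true.1 parent_check n (by omega)
    simp only [force_eq, Bool.and_eq_true, Bool.or_eq_true, Nat.blt_eq, Nat.beq_eq] at this
    obtain ⟨⟨hm, hlt⟩, hpar⟩ := this
    have key : ∀ s t, isSym s t = true →
        digit 1000 t (digit 1000 (digit (1000 ^ 2) parentCode n) 0) = n →
        ∃ W', IsLabelling W' ∧ (tetSet 599).image W' = (tetSet n).image W := by
      intro s t hst hmn
      obtain ⟨W', hW', e⟩ := ih _ hm (by omega) _ (hW.comp hst)
      refine ⟨W', hW', e.trans ?_⟩
      have e2 := ((isSym_spec hst).2.2 _ hm).2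
      rw [hmn] at e2
      rw [e2, Finset.image_image]
    rcases hpar with hpar | hpar
    exacts [key _ _ sym_check₁ hpar, key _ _ sym_check₂ hpar]

/-! ### The complex with 543 tetrahedra -/

theorem lt_of_mem_tetSet_of_lt {n i : ℕ} (hn : n < 543) (hi : i ∈ tetSet n) : i < 116 := by
  have h := allBelow_eq_true.1 disjoint_check n hn
  simp only [withTet_eq, Bool.and_eq_true, Nat.blt_eq] at h
  rw [mem_tetSet] at hi
  rcases hi with rfl | rfl | rfl | rfl <;> tauto

theorem tetSet_last : tetSet 599 = {116, 117, 118, 119} := by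
  symm
  apply Finset.eq_of_subset_of_card_le
  · have h := last_check
    rw [withTet_eq, allBelow_eq_true] at h
    simp only [isOneOf_eq_true, ← mem_tetSet] at h
    have h0 := h 0 (by norm_num)
    have h1 := h 1 (by norm_num)
    have h2 := h 2 (by norm_num)
    have h3 := h 3 (by norm_num)
    intro i hi
    simp only [Finset.mem_insert, Finset.mem_singleton] at hi
    rcases hi with rfl | rfl | rfl | rfl <;> assumption
  · rw [card_tetSet (by norm_num)]
    rfl

theorem exists_cover {n : ℕ} (hn : n < 599) :
    ∃ m < 543, ∀ i ∈ tetSet n, i < 116 → i ∈ tetSet m := by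
  by_cases hn' : n < 543
  · exact ⟨n, hn', fun i hi _ => hi⟩
  have h := allBelow_eq_true.1 cover_check (n - 543) (by omega)
  rw [withTet_eq, show Nat.add 543 (n - 543) = n by change 543 + (n - 543) = n; omega] at h
  simp only [force_eq, withTet_eq, Bool.and_eq_true, Bool.or_eq_true, Nat.blt_eq, Nat.ble_eq,
    isOneOf_eq_true, ← mem_tetSet] at h
  obtain ⟨hm, ⟨⟨h0, h1⟩, h2⟩, h3⟩ := h
  refine ⟨_, hm, fun i hi hlt => ?_⟩
  rw [mem_tetSet] at hi
  rcases hi with rfl | rfl | rfl | rfl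
  exacts [h0.resolve_left (by omega), h1.resolve_left (by omega), h2.resolve_left (by omega),
    h3.resolve_left (by omega)]

/-- The index family of the complex with 543 tetrahedra. -/
def tets543 : Set (Finset ℕ) := {t | ∃ n < 543, t = tetSet n}

-- After relabelling, σ is tetrahedron 599, so membership in σ means an index of at least 116. The
-- complex is then generated by the first 543 tetrahedra: they avoid σ, and `exists_cover` places
-- every face avoiding σ in one of them.
open Classical in
theorem exists_X543_faces_eq {σ : Finset (Euc 4)} (hσ : σ ∈ X600.faces) (hcard : σ.card = 4) :
    ∃ W : ℕ → Euc 4, Set.InjOn W (Set.Iio 120) ∧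
      (X543 σ).faces = {s | s.Nonempty ∧ ∃ t ∈ tets543, s ⊆ t.image W} := by
  have hσ' := hσ
  rw [isLabelling_vert.faces_eq] at hσ'
  obtain ⟨-, n, hn, hsub⟩ := hσ'
  have hσn : σ = (tetSet n).image vert := by
    refine Finset.eq_of_subset_of_card_le (by convert hsub) ?_
    exact Finset.card_image_le.trans (by rw [hcard, card_tetSet hn])
  obtain ⟨W, hW, hWσ⟩ := exists_isLabelling _ n hn le_rfl vert isLabelling_vert
  have hσW : σ = (tetSet 599).image W := by
    rw [hσn]
    convert hWσ.symm
  have hmemσ : ∀ i < 120, (W i ∈ σ ↔ 116 ≤ i) := by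
    intro i hi
    rw [hσW, Finset.mem_image]
    constructor
    · rintro ⟨j, hj, hji⟩
      rw [← hW.injOn (lt_of_mem_tetSet (by norm_num) hj) hi hji]
      rw [tetSet_last] at hj
      simp only [Finset.mem_insert, Finset.mem_singleton] at hj
      omega
    · intro hi'
      refine ⟨i, ?_, rfl⟩
      rw [tetSet_last]
      simp only [Finset.mem_insert, Finset.mem_singleton]
      omega
  refine ⟨W, hW.injOn, ?_⟩
  ext s
  change (s ∈ X600.faces ∧ Disjoint s σ) ↔ _
  rw [hW.faces_eq]
  constructor
  · rintro ⟨⟨hne, m, hm, hs⟩, hdis⟩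
    have hlt : ∀ i ∈ tetSet m, W i ∈ s → i < 116 := by
      intro i hi his
      by_contra hge
      exact Finset.disjoint_left.1 hdis his
        ((hmemσ i (lt_of_mem_tetSet hm hi)).2 (by omega))
    have hm' : m < 599 := by
      by_contra hge
      obtain rfl : m = 599 := by omega
      obtain ⟨v, hv⟩ := hne
      obtain ⟨i, hi, rfl⟩ := Finset.mem_image.1 (hs hv)
      have := hlt i hi hv
      rw [tetSet_last] at hi
      simp only [Finset.mem_insert, Finset.mem_singleton] at hi
      omega
    obtain ⟨k, hk, hcov⟩ := exists_cover hm'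
    refine ⟨hne, _, ⟨k, hk, rfl⟩, fun v hv => ?_⟩
    obtain ⟨i, hi, rfl⟩ := Finset.mem_image.1 (hs hv)
    exact Finset.mem_image_of_mem _ (hcov i hi (hlt i hi hv))
  · rintro ⟨hne, _, ⟨m, hm, rfl⟩, hs⟩
    refine ⟨⟨hne, m, by omega, by convert hs⟩, Finset.disjoint_left.2 fun v hv hvσ => ?_⟩
    obtain ⟨i, hi, rfl⟩ := Finset.mem_image.1 (hs hv)
    have h1 := lt_of_mem_tetSet_of_lt hm hi
    have h2 := (hmemσ i (by omega)).1 hvσ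
    omega

/-! ### Acute and Delaunay tetrahedra in the grid -/

/-- The vector in Euclidean space. -/
noncomputable def DiffVec.toEuc (u : DiffVec) : Euc 3 :=
  !₂[(u.x.val : ℝ), (u.y.val : ℝ), (u.z.val : ℝ)]

theorem DiffVec.val_dot (u v : DiffVec) :
    (u.dot v).val = u.x.val * v.x.val + u.y.val * v.y.val + u.z.val * v.z.val := by
  simp [dot]

theorem DiffVec.inner_toEuc (u v : DiffVec) : inner ℝ u.toEuc v.toEuc = ((u.dot v).val : ℝ) := by
  rw [val_dot, PiLp.inner_apply, Fin.sum_univ_three]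
  simp [toEuc, mul_comm]

theorem DiffVec.toEuc_sub (u v : DiffVec) : (u - v).toEuc = u.toEuc - v.toEuc := by
  have h : u - v = ⟨u.x - v.x, u.y - v.y, u.z - v.z⟩ := rfl
  ext i
  fin_cases i <;> simp [toEuc, h]

/-- The acuteness criterion for the dihedral angle at `ab` of the tetrahedron `abcd`. -/
def AcuteAt (a b c d : Euc 3) : Prop :=
  inner ℝ (b - a) (c - a) * inner ℝ (b - a) (d - a) <
    inner ℝ (c - a) (d - a) * inner ℝ (b - a) (b - a)

theorem AcuteAt.swap_right {a b c d : Euc 3} (h : AcuteAt a b c d) : AcuteAt a b d c := by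
  rw [AcuteAt, real_inner_comm (c - a) (d - a), mul_comm (inner ℝ (b - a) (d - a))]
  exact h

theorem AcuteAt.swap_left {a b c d : Euc 3} (h : AcuteAt a b c d) : AcuteAt b a c d := by
  have e1 : a - b = -(b - a) := (neg_sub b a).symm
  have e2 : c - b = c - a - (b - a) := (sub_sub_sub_cancel_right c b a).symm
  have e3 : d - b = d - a - (b - a) := (sub_sub_sub_cancel_right d b a).symm
  rw [AcuteAt, e1, e2, e3]
  -- The quantity ⟨x, y⟩⟨u, u⟩ - ⟨u, x⟩⟨u, y⟩ is unchanged when x and y are shifted by u and u is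
  -- negated.
  have key : ∀ u x y : Euc 3, inner ℝ u x * inner ℝ u y < inner ℝ x y * inner ℝ u u →
      inner ℝ (-u) (x - u) * inner ℝ (-u) (y - u) <
        inner ℝ (x - u) (y - u) * inner ℝ (-u) (-u) := by
    intro u x y h
    simp only [inner_neg_left, inner_neg_right, inner_sub_left, inner_sub_right,
      real_inner_comm u x]
    linarith
  exact key _ _ _ h

theorem acuteAt_of_isAcuteAt {a b c d : DiffVec} (h : isAcuteAt a b c d = true) {k : ℝ}
    (hk : 0 < k) : AcuteAt (k • a.toEuc) (k • b.toEuc) (k • c.toEuc) (k • d.toEuc) := by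
  simp only [isAcuteAt, DiffVec.force_eq, Diff.lt_eq_true, Diff.val_mul] at h
  have h' := (Int.cast_lt (R := ℝ)).2 h
  push_cast at h'
  simp only [AcuteAt, ← smul_sub, ← DiffVec.toEuc_sub, real_inner_smul_left, real_inner_smul_right,
    DiffVec.inner_toEuc]
  -- Both sides of the criterion are homogeneous of degree 4.
  have := mul_lt_mul_of_pos_left h' (show 0 < k ^ 4 by positivity)
  linarith

theorem AcuteAt.isAcuteSimplex {a b c d : Euc 3} {t : Finset (Euc 3)}
    (ht : ∀ v ∈ t, v = a ∨ v = b ∨ v = c ∨ v = d)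
    (h1 : AcuteAt a b c d) (h2 : AcuteAt a c b d) (h3 : AcuteAt a d b c) (h4 : AcuteAt b c a d)
    (h5 : AcuteAt b d a c) (h6 : AcuteAt c d a b) : IsAcuteSimplex t := by
  -- One inequality for each of the six edges suffices: the criterion is symmetric in the ends of
  -- the edge and in the two opposite vertices.
  have key : ∀ i j k l : Fin 4, [i, j, k, l].Nodup →
      AcuteAt (![a, b, c, d] i) (![a, b, c, d] j) (![a, b, c, d] k) (![a, b, c, d] l) := by
    intro i j k l hnd
    fin_cases i <;> fin_cases j <;> fin_cases k <;> fin_cases l <;>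
      first
      | exact absurd hnd (by decide)
      | exact h1 | exact h2 | exact h3 | exact h4 | exact h5 | exact h6
      | exact h1.swap_left | exact h2.swap_left | exact h3.swap_left | exact h4.swap_left
      | exact h5.swap_left | exact h6.swap_left
      | exact h1.swap_right | exact h2.swap_right | exact h3.swap_right | exact h4.swap_right
      | exact h5.swap_right | exact h6.swap_right
      | exact h1.swap_left.swap_right | exact h2.swap_left.swap_right
      | exact h3.swap_left.swap_right | exact h4.swap_left.swap_right
      | exact h5.swap_left.swap_right | exact h6.swap_left.swap_right
  have hex : ∀ v ∈ t, ∃ i, ![a, b, c, d] i = v := by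
    intro v hv
    rcases ht v hv with rfl | rfl | rfl | rfl
    exacts [⟨0, rfl⟩, ⟨1, rfl⟩, ⟨2, rfl⟩, ⟨3, rfl⟩]
  intro x hx y hy z hz w hw hnd
  obtain ⟨i, rfl⟩ := hex x hx
  obtain ⟨j, rfl⟩ := hex y hy
  obtain ⟨k, rfl⟩ := hex z hz
  obtain ⟨l, rfl⟩ := hex w hw
  exact dihedralAngle_lt_pi_div_two (key i j k l (List.Nodup.of_map ![a, b, c, d] hnd))

theorem withPoints_eq (P n : ℕ) (k : List NormedPoint → Bool) :
    ∃ l : List NormedPoint, (∀ i < n, normedPoint P i ∈ l) ∧ withPoints P n k = k l := by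
  induction n generalizing k with
  | zero => exact ⟨[], by simp, rfl⟩
  | succ n ih =>
    obtain ⟨l, hl, h⟩ := ih fun l => k (normedPoint P n :: l)
    refine ⟨normedPoint P n :: l, fun i hi => ?_, ?_⟩
    · rcases Nat.lt_succ_iff_lt_or_eq.1 hi with h | rfl
      exacts [List.mem_cons_of_mem _ (hl i h), List.mem_cons_self]
    · rw [← h]
      change (normedPoint P n).force (fun u => withPoints P n fun l => k (u :: l)) = _
      simp [NormedPoint.force]

theorem allOf_eq_true {f : NormedPoint → Bool} {l : List NormedPoint} (h : allOf f l = true)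
    {u : NormedPoint} (hu : u ∈ l) : f u = true := by
  induction l with
  | nil => simp at hu
  | cons v l ih =>
    have h' : cond (f v) (allOf f l) false = true := h
    rw [Bool.cond_false_right, Bool.and_eq_true] at h'
    rcases List.mem_cons.1 hu with rfl | hu
    exacts [h'.1, ih h'.2 hu]

theorem sphereTest_spec {D F : Diff} {E : DiffVec} {i j k l P n : ℕ}
    (h : sphereTest D F E i j k l (normedPoint P n) = true) :
    (n = i ∨ n = j ∨ n = k ∨ n = l) ∨
      (E.dot (point P n)).val < D.val * ((point P n).dot (point P n)).val + F.val := by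
  rw [sphereTest, Bool.cond_true_left, Bool.or_eq_true, isOneOf_eq_true, Nat.blt_eq] at h
  refine h.symm.imp id fun h => ?_
  have h' := (Int.ofNat_lt (n := _) (m := _)).2 h
  simp only [normedPoint, Nat.add_eq, Nat.mul_eq, Nat.cast_add, Nat.cast_mul] at h'
  rw [DiffVec.val_dot, DiffVec.val_dot]
  simp only [point, Diff.val, Nat.cast_zero, sub_zero]
  linarith

/-- With A = `sphereGrad`, the sphere through the four points is A·(u - a) = D|u - a|². Expanding
gives E·u = D|u|² + F with E = A + 2Da and F = D|a|² + A·a, and for D > 0 the points outside are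
those with E·u < D|u|² + F. -/
theorem isDelaunay_spec {L : List NormedPoint} {i j k l P : ℕ}
    (hL : ∀ n < 116, normedPoint P n ∈ L) {a b c d : DiffVec}
    (h : isDelaunay L i j k l a b c d = true) :
    0 < (det (b - a) (c - a) (d - a)).val ∧ ∃ (D F : ℤ) (E : DiffVec), 0 < D ∧
      (∀ u ∈ [a, b, c, d], (E.dot u).val = D * (u.dot u).val + F) ∧
      ∀ n < 116, ¬ (n = i ∨ n = j ∨ n = k ∨ n = l) →
        (E.dot (point P n)).val < D * ((point P n).dot (point P n)).val + F := by
  simp only [isDelaunay, DiffVec.force_eq, Diff.force_eq, Bool.and_eq_true, Diff.lt_eq_true] at h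
  obtain ⟨hD, h⟩ := h
  have hD : 0 < (det (b - a) (c - a) (d - a)).val := hD
  refine ⟨hD, (det (b - a) (c - a) (d - a)).val, _, _, hD, ?_, fun n hn hne =>
    (sphereTest_spec (allOf_eq_true h (hL n hn))).resolve_left hne⟩
  have hsub : ∀ u v : DiffVec, u - v = ⟨u.x - v.x, u.y - v.y, u.z - v.z⟩ := fun _ _ => rfl
  have hadd : ∀ u v : DiffVec, u + v = ⟨u.x + v.x, u.y + v.y, u.z + v.z⟩ := fun _ _ => rfl
  intro u hu
  simp only [sphereGrad, det, DiffVec.cross, DiffVec.smul, DiffVec.val_dot, hsub, hadd,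
    Diff.val_add, Diff.val_sub, Diff.val_mul]
  simp only [List.mem_cons, List.not_mem_nil, or_false] at hu
  rcases hu with rfl | rfl | rfl | rfl <;> ring

/-! ### Soundness of the checks -/

/-- If `j` is not in the simplex `n` containing `i`, then the interpolant of `n` agrees with `h` at
the point of `i` but is smaller at the point of `j`, so the points differ. -/
theorem injOn_of_tetSet {E β : Type*} {loc : ℕ → E} {h : E → β} {l : ℕ → E → β}
    [Preorder β] (hinj : ∀ n < 543, Set.InjOn loc (tetSet n))
    (heq : ∀ n < 543, ∀ i ∈ tetSet n, l n (loc i) = h (loc i))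
    (hlt : ∀ n < 543, ∀ i < 116, i ∉ tetSet n → l n (loc i) < h (loc i)) :
    Set.InjOn loc {i | ∃ t ∈ tets543, i ∈ t} := by
  rintro i ⟨_, ⟨n, hn, rfl⟩, hi⟩ j ⟨_, ⟨m, hm, rfl⟩, hj⟩ hij
  by_cases hjn : j ∈ tetSet n
  · exact hinj n hn hi hjn hij
  · have := hlt n hn j (lt_of_mem_tetSet_of_lt hm hj) hjn
    rw [← hij, heq n hn i hi] at this
    exact absurd this (lt_irrefl _)

/-- A realization of the complex `X₅₄₃` as a regular triangulation of `S`. -/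
theorem exists_acuteTriangulation {loc : ℕ → Euc 3} {S : Set (Euc 3)} (hS : Convex ℝ S)
    (hmem : ∀ i < 116, loc i ∈ S)
    (hind : ∀ n < 543, AffineIndependent ℝ fun r : Fin 4 => loc (tetVertex n r))
    (h : Euc 3 → ℝ) (l : ℕ → Euc 3 →ᵃ[ℝ] ℝ)
    (heq : ∀ n < 543, ∀ i ∈ tetSet n, l n (loc i) = h (loc i))
    (hlt : ∀ n < 543, ∀ i < 116, i ∉ tetSet n → l n (loc i) < h (loc i))
    (hfacet : ∀ n < 543, ∀ r < 4, nbr n r < 543 ∨ ∃ m : Euc 3 →ᵃ[ℝ] ℝ, (∀ x ∈ S, 0 ≤ m x) ∧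
      (∀ i ∈ (tetSet n).erase (tetVertex n r), m (loc i) = 0) ∧ 0 < m (loc (tetVertex n r)))
    (hacute : ∀ n < 543, ∀ t : Finset (Euc 3), (∀ v ∈ t, ∃ i ∈ tetSet n, loc i = v) →
      IsAcuteSimplex t)
    (hint : ∀ i k, ∃ m : ℤ, loc i k = m)
    {σ : Finset (Euc 4)} (hσ : σ ∈ X600.faces) (hcard : σ.card = 4) :
    ∃ K : Geometry.SimplicialComplex ℝ (Euc 3), IsAcuteTriangulation K S ∧
      CombinatoriallyEquivalent K.toPreAbstractSimplicialComplex (X543 σ) ∧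
      (tetrahedra K).ncard = 543 ∧ ∀ v ∈ K.vertices, ∀ i, ∃ m : ℤ, v i = m := by
  classical
  have hinj : ∀ n < 543, Set.InjOn loc (tetSet n) := by
    intro n hn i hi j hj hij
    obtain ⟨r, hr, rfl⟩ := exists_tetVertex_eq hi
    obtain ⟨s, hs, rfl⟩ := exists_tetVertex_eq hj
    have := (hind n hn).injective (a₁ := ⟨r, hr⟩) (a₂ := ⟨s, hs⟩) hij
    rw [Fin.mk.injEq] at this
    rw [this]
  have hU := injOn_of_tetSet (l := fun n => l n) hinj heq hlt
  have hTU : ∀ n < 543, (tetSet n : Set ℕ) ⊆ {i | ∃ t ∈ tets543, i ∈ t} :=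
    fun n hn i hi => ⟨_, ⟨n, hn, rfl⟩, hi⟩
  obtain ⟨𝒯, h𝒯eq⟩ : ∃ 𝒯 : Finset (Finset (Euc 3)),
      𝒯 = (Finset.range 543).image fun n => (tetSet n).image loc := ⟨_, rfl⟩
  have h𝒯 : ∀ T, T ∈ 𝒯 ↔ ∃ n < 543, (tetSet n).image loc = T := by simp [h𝒯eq]
  have h4 : ∀ n < 543, ((tetSet n).image loc).card = 4 := fun n hn => by
    rw [Finset.card_image_of_injOn (hinj n hn), card_tetSet (by omega)]
  have hmemT : ∀ n < 543, ∀ i ∈ {i | ∃ t ∈ tets543, i ∈ t},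
      loc i ∈ (tetSet n).image loc → i ∈ tetSet n := by
    intro n hn i hi h
    obtain ⟨j, hj, hij⟩ := Finset.mem_image.1 h
    rwa [← hU (hTU n hn hj) hi hij]
  -- The general criterion indexes the interpolants by the simplices themselves, so each simplex
  -- needs a chosen number.
  choose! g hg using fun T hT => (h𝒯 T).1 hT
  obtain ⟨K, hK, hspace⟩ := exists_simplicialComplex_of_regular (𝒯 := 𝒯) (P := S)
    ⟨_, (h𝒯 _).2 ⟨0, by norm_num, rfl⟩⟩
    (by
      intro T hT
      obtain ⟨n, hn, rfl⟩ := (h𝒯 T).1 hT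
      rw [h4 n hn, finrank_euclideanSpace_fin])
    (by
      intro T hT
      obtain ⟨n, hn, rfl⟩ := (h𝒯 T).1 hT
      refine (hind n hn).range.mono (s := (((tetSet n).image loc : Finset _) : Set (Euc 3))) ?_
      intro v hv
      obtain ⟨i, hi, rfl⟩ := Finset.mem_image.1 (Finset.mem_coe.1 hv)
      obtain ⟨r, hr, rfl⟩ := exists_tetVertex_eq hi
      exact ⟨⟨r, hr⟩, rfl⟩)
    hS
    (by
      intro T hT v hv
      obtain ⟨n, hn, rfl⟩ := (h𝒯 T).1 hT
      obtain ⟨i, hi, rfl⟩ := Finset.mem_image.1 (Finset.mem_coe.1 hv)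
      exact hmem i (lt_of_mem_tetSet_of_lt hn hi))
    h (fun T => l (g T))
    (by
      intro T hT v hv
      obtain ⟨hn, hT'⟩ := hg T hT
      rw [← hT'] at hv
      obtain ⟨i, hi, rfl⟩ := Finset.mem_image.1 hv
      exact heq _ hn i hi)
    (by
      intro T hT T' hT' v hv hvT
      obtain ⟨hn, hTn⟩ := hg T hT
      obtain ⟨m, hm, rfl⟩ := (h𝒯 T').1 hT'
      obtain ⟨i, hi, rfl⟩ := Finset.mem_image.1 hv
      refine hlt _ hn i (lt_of_mem_tetSet_of_lt hm hi) fun hi' => hvT ?_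
      rw [← hTn]
      exact Finset.mem_image_of_mem _ hi')
    (by
      intro T hT v hv
      obtain ⟨n, hn, rfl⟩ := (h𝒯 T).1 hT
      obtain ⟨i, hi, rfl⟩ := Finset.mem_image.1 hv
      obtain ⟨r, hr, rfl⟩ := exists_tetVertex_eq hi
      have herase : ∀ u ∈ ((tetSet n).image loc).erase (loc (tetVertex n r)),
          ∃ j ∈ (tetSet n).erase (tetVertex n r), loc j = u := by
        intro u hu
        obtain ⟨hne, hu⟩ := Finset.mem_erase.1 hu
        obtain ⟨j, hj, rfl⟩ := Finset.mem_image.1 hu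
        exact ⟨j, Finset.mem_erase.2 ⟨fun e => hne (e ▸ rfl), hj⟩, rfl⟩
      rcases hfacet n hn r hr with h | ⟨m, hm, hm0, hmpos⟩
      · obtain ⟨-, hsub, hnot⟩ := nbr_spec (n := n) (k := r) (by omega) hr
        refine Or.inl ⟨_, (h𝒯 _).2 ⟨nbr n r, h, rfl⟩, fun u hu => ?_, fun hv' => hnot ?_⟩
        · obtain ⟨j, hj, rfl⟩ := herase u hu
          exact Finset.mem_image_of_mem _ (hsub hj)
        · exact hmemT _ h _ (hTU n hn hi) hv'
      · refine Or.inr ⟨m, hm, fun u hu => ?_, hmpos⟩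
        obtain ⟨j, hj, rfl⟩ := herase u hu
        exact hm0 j hj)
  have hfaces : K.faces = {s | s.Nonempty ∧ ∃ t ∈ tets543, s ⊆ t.image loc} := by
    rw [hK]
    ext s
    simp only [h𝒯, tets543, Set.mem_ofPred_eq]
    refine and_congr_right fun _ => ⟨?_, ?_⟩
    · rintro ⟨_, ⟨n, hn, rfl⟩, hs⟩
      exact ⟨_, ⟨n, hn, rfl⟩, hs⟩
    · rintro ⟨_, ⟨n, hn, rfl⟩, hs⟩
      exact ⟨_, ⟨n, hn, rfl⟩, hs⟩
  -- A face with four vertices is contained in a generating simplex of the same size, hence equal to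
  -- it.
  have htet : tetrahedra K = 𝒯 := by
    ext s
    simp only [tetrahedra, Set.mem_ofPred_eq, hK, Finset.mem_coe]
    constructor
    · rintro ⟨⟨-, T, hT, hsT⟩, hs⟩
      obtain ⟨n, hn, rfl⟩ := (h𝒯 T).1 hT
      rwa [Finset.eq_of_subset_of_card_le hsT (by rw [h4 n hn, hs])]
    · intro hs
      obtain ⟨n, hn, rfl⟩ := (h𝒯 s).1 hs
      refine ⟨⟨?_, _, hs, subset_rfl⟩, h4 n hn⟩
      rw [← Finset.card_pos, h4 n hn]
      norm_num
  obtain ⟨W, hW, hX⟩ := exists_X543_faces_eq hσ hcard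
  refine ⟨K, ⟨?_, hspace, ?_, ?_⟩, ?_, ?_, ?_⟩
  · rw [hK]
    refine (𝒯.biUnion Finset.powerset).finite_toSet.subset ?_
    intro s hs
    obtain ⟨T, hT, hs⟩ := hs.2
    rw [Finset.mem_coe, Finset.mem_biUnion]
    exact ⟨T, hT, Finset.mem_powerset.2 hs⟩
  · intro s hs
    rw [hK] at hs
    rw [htet]
    exact hs.2
  · intro t ht
    rw [htet] at ht
    obtain ⟨n, hn, rfl⟩ := (h𝒯 t).1 ht
    exact hacute n hn _ fun v hv => Finset.mem_image.1 hv
  · refine combinatoriallyEquivalent_of_image tets543 rfl hU (hW.mono ?_) hfaces ?_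
    · rintro i ⟨_, ⟨n, hn, rfl⟩, hi⟩
      exact lt_of_mem_tetSet (by omega) hi
    · convert hX
  · rw [htet, Set.ncard_coe_finset, h𝒯eq, Finset.card_image_of_injOn, Finset.card_range]
    intro n hn m hm hnm
    rw [Finset.mem_coe, Finset.mem_range] at hn hm
    have hnm : (tetSet n).image loc = (tetSet m).image loc := hnm
    refine tetSet_injOn (show n < 600 by omega) (show m < 600 by omega) ?_
    refine Finset.Subset.antisymm (fun i hi => ?_) fun i hi => ?_
    · exact hmemT m hm i (hTU n hn hi) (hnm ▸ Finset.mem_image_of_mem loc hi)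
    · exact hmemT n hn i (hTU m hm hi) (hnm ▸ Finset.mem_image_of_mem loc hi)
  · intro v hv
    have hv : ({v} : Finset (Euc 3)) ∈ K.faces := hv
    rw [hfaces] at hv
    obtain ⟨-, t, -, hs⟩ := hv
    obtain ⟨i, -, rfl⟩ := Finset.mem_image.1 (hs (Finset.mem_singleton_self v))
    exact hint i

/-- Cramer's rule: eliminating the weight of `a` leaves a 3 × 3 system with nonzero determinant, and
the coefficients in the combinations below are its cofactors. -/
theorem affineIndependent_of_det {a b c d : DiffVec}
    (h : 0 < (det (b - a) (c - a) (d - a)).val) {k : ℝ} (hk : 0 < k) :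
    AffineIndependent ℝ ![k • a.toEuc, k • b.toEuc, k • c.toEuc, k • d.toEuc] := by
  have hsub : ∀ u v : DiffVec, u - v = ⟨u.x - v.x, u.y - v.y, u.z - v.z⟩ := fun _ _ => rfl
  simp only [det, DiffVec.cross, DiffVec.val_dot, hsub, Diff.val_sub, Diff.val_mul] at h
  have h := (Int.cast_pos (R := ℝ)).2 h
  push_cast at h
  rw [affineIndependent_iff_of_fintype]
  intro w hw hw0
  rw [Finset.univ.weightedVSub_eq_linear_combination hw, Fin.sum_univ_four] at hw0
  rw [Fin.sum_univ_four] at hw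
  have e : ∀ i,
      k * (w 0 * a.toEuc i + w 1 * b.toEuc i + w 2 * c.toEuc i + w 3 * d.toEuc i) = 0 := by
    intro i
    have := congrArg (fun v : Euc 3 => v i) hw0
    simp only [Matrix.cons_val, PiLp.add_apply, PiLp.smul_apply, smul_eq_mul, PiLp.zero_apply]
      at this
    linear_combination this
  have e : ∀ i, w 0 * a.toEuc i + w 1 * b.toEuc i + w 2 * c.toEuc i + w 3 * d.toEuc i = 0 :=
    fun i => (mul_eq_zero.1 (e i)).resolve_left hk.ne'
  have e0 := e 0
  have e1 := e 1
  have e2 := e 2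
  simp only [DiffVec.toEuc, Matrix.cons_val] at e0 e1 e2
  generalize (a.x.val : ℝ) = ax at *
  generalize (a.y.val : ℝ) = ay at *
  generalize (a.z.val : ℝ) = az at *
  generalize (b.x.val : ℝ) = bx at *
  generalize (b.y.val : ℝ) = b_y at *
  generalize (b.z.val : ℝ) = bz at *
  generalize (c.x.val : ℝ) = cx at *
  generalize (c.y.val : ℝ) = cy at *
  generalize (c.z.val : ℝ) = cz at *
  generalize (d.x.val : ℝ) = dx at *
  generalize (d.y.val : ℝ) = dy at *
  generalize (d.z.val : ℝ) = dz at *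
  have e0' : w 1 * (bx - ax) + w 2 * (cx - ax) + w 3 * (dx - ax) = 0 := by
    linear_combination e0 - ax * hw
  have e1' : w 1 * (b_y - ay) + w 2 * (cy - ay) + w 3 * (dy - ay) = 0 := by
    linear_combination e1 - ay * hw
  have e2' : w 1 * (bz - az) + w 2 * (cz - az) + w 3 * (dz - az) = 0 := by
    linear_combination e2 - az * hw
  generalize bx - ax = bx at *
  generalize b_y - ay = b_y at *
  generalize bz - az = bz at *
  generalize cx - ax = cx at *
  generalize cy - ay = cy at *
  generalize cz - az = cz at *
  generalize dx - ax = dx at *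
  generalize dy - ay = dy at *
  generalize dz - az = dz at *
  have w1 : w 1 = 0 := by
    refine (mul_eq_zero.1 ?_).resolve_left h.ne'
    linear_combination (cy * dz - cz * dy) * e0' + (cz * dx - cx * dz) * e1' +
      (cx * dy - cy * dx) * e2'
  have w2 : w 2 = 0 := by
    refine (mul_eq_zero.1 ?_).resolve_left h.ne'
    linear_combination (dy * bz - dz * b_y) * e0' + (dz * bx - dx * bz) * e1' +
      (dx * b_y - dy * bx) * e2'
  have w3 : w 3 = 0 := by
    refine (mul_eq_zero.1 ?_).resolve_left h.ne'
    linear_combination (b_y * cz - bz * cy) * e0' + (bz * cx - bx * cz) * e1' +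
      (bx * cy - b_y * cx) * e2'
  have w0 : w 0 = 0 := by
    rw [w1, w2, w3] at hw
    linarith
  intro i
  fin_cases i
  exacts [w0, w1, w2, w3]

/-- The affine functional with gradient `g` and constant term `c`, in a scaled copy of the grid. -/
noncomputable def affineFunctional (k : ℝ) (g : DiffVec) (c : ℤ) : Euc 3 →ᵃ[ℝ] ℝ :=
  (innerₛₗ ℝ g.toEuc).toAffineMap + AffineMap.const ℝ (Euc 3) (k * c)

theorem affineFunctional_apply (k : ℝ) (g : DiffVec) (c : ℤ) (x : Euc 3) :
    affineFunctional k g c x = inner ℝ g.toEuc x + k * c := rfl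

theorem affineFunctional_smul (k : ℝ) (g : DiffVec) (c : ℤ) (u : DiffVec) :
    affineFunctional k g c (k • u.toEuc) = k * (((g.dot u).val + c : ℤ) : ℝ) := by
  rw [affineFunctional_apply, real_inner_smul_right, DiffVec.inner_toEuc]
  push_cast
  ring

theorem isFacetOf_spec {a b c d : DiffVec} {M : List (DiffVec × Diff)}
    (h : M.any (isFacetOf a b c d) = true) : ∃ m ∈ M, (m.1.dot b).val + m.2.val = 0 ∧
      (m.1.dot c).val + m.2.val = 0 ∧ (m.1.dot d).val + m.2.val = 0 ∧
      0 < (m.1.dot a).val + m.2.val := by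
  obtain ⟨m, hm, h⟩ := List.any_eq_true.1 h
  simp only [isFacetOf, Bool.and_eq_true, Diff.eq_eq_true, Diff.lt_eq_true, evalAffine,
    Diff.val_add, Diff.val_mk, Nat.cast_zero, sub_zero] at h
  exact ⟨m, hm, h.1.1.1, h.1.1.2, h.1.2, h.2⟩

theorem exists_of_isGood {P : ℕ} {M : List (DiffVec × Diff)} (h : isGood P M = true) {k : ℤ}
    (hk : 0 < k) {S : Set (Euc 3)} (hS : Convex ℝ S)
    (hSM : S = {x | ∀ m ∈ M, 0 ≤ affineFunctional k m.1 m.2.val x})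
    {σ : Finset (Euc 4)} (hσ : σ ∈ X600.faces) (hcard : σ.card = 4) :
    ∃ K : Geometry.SimplicialComplex ℝ (Euc 3), IsAcuteTriangulation K S ∧
      CombinatoriallyEquivalent K.toPreAbstractSimplicialComplex (X543 σ) ∧
      (tetrahedra K).ncard = 543 ∧ ∀ v ∈ K.vertices, ∀ i, ∃ m : ℤ, v i = m := by
  have hk' : (0 : ℝ) < k := Int.cast_pos.2 hk
  rw [isGood, force_eq, Bool.and_eq_true] at h
  obtain ⟨hmem, h⟩ := h
  obtain ⟨L, hL, hLe⟩ := withPoints_eq P 116 fun L => allBelow 543 fun n =>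
    withTet n fun i j k l =>
    (point P i).force fun a => (point P j).force fun b =>
    (point P k).force fun c => (point P l).force fun d =>
      isAcute a b c d && isDelaunay L i j k l a b c d &&
      (Nat.blt (nbr n 0) 543 || M.any (isFacetOf a b c d)) &&
      (Nat.blt (nbr n 1) 543 || M.any (isFacetOf b a c d)) &&
      (Nat.blt (nbr n 2) 543 || M.any (isFacetOf c a b d)) &&
      (Nat.blt (nbr n 3) 543 || M.any (isFacetOf d a b c))
  rw [hLe, allBelow_eq_true] at h
  simp only [withTet_eq, DiffVec.force_eq, Bool.and_eq_true, Bool.or_eq_true, Nat.blt_eq] at h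
  have hdel := fun n (hn : n < 543) => isDelaunay_spec hL (h n hn).1.1.1.1.2
  -- Supplies `choose!` with a default vector for indices outside the range.
  have : Nonempty DiffVec := ⟨point P 0⟩
  choose! hdet D F E hD heq hlt using hdel
  have hpos : ∀ n < 543, (0 : ℝ) < D n := fun n hn => Int.cast_pos.2 (hD n hn)
  -- At x = k u the height ⟨x, x⟩/k is k|u|², and the interpolant is k(E·u - F)/D. Dividing by k
  -- thus makes both sides scale linearly, and the integer inequalities apply.
  refine exists_acuteTriangulation (loc := fun i => (k : ℝ) • (point P i).toEuc) hS ?_ ?_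
    (fun x => inner ℝ x x / k) (fun n => (D n : ℝ)⁻¹ • affineFunctional k (E n) (-F n))
    ?_ ?_ ?_ ?_ ?_ hσ hcard
  · intro i hi
    rw [hSM]
    intro m hm
    have h := allBelow_eq_true.1 hmem i hi
    rw [DiffVec.force_eq, List.all_eq_true] at h
    have h := h m hm
    rw [Diff.le_eq_true, evalAffine, Diff.val_add] at h
    rw [affineFunctional_smul]
    exact mul_nonneg hk'.le (Int.cast_nonneg h)
  · intro n hn
    convert affineIndependent_of_det (hdet n hn) hk' using 1
    ext r : 1
    fin_cases r <;> rfl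
  · intro n hn i hi
    have hi' : ((E n).dot (point P i)).val = D n * ((point P i).dot (point P i)).val + F n := by
      refine heq n hn _ ?_
      rcases mem_tetSet.1 hi with rfl | rfl | rfl | rfl <;> simp
    rw [AffineMap.coe_smul, Pi.smul_apply, affineFunctional_smul, real_inner_smul_left,
      real_inner_smul_right, DiffVec.inner_toEuc, hi']
    have := (hpos n hn).ne'
    push_cast
    rw [smul_eq_mul]
    field_simp
    ring
  · intro n hn i hi hi'
    have h := (Int.cast_lt (R := ℝ)).2 (hlt n hn i hi (by rwa [← mem_tetSet]))
    push_cast at h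
    rw [AffineMap.coe_smul, Pi.smul_apply, affineFunctional_smul, real_inner_smul_left,
      real_inner_smul_right, DiffVec.inner_toEuc, smul_eq_mul, inv_mul_lt_iff₀ (hpos n hn)]
    push_cast
    rw [show (D n : ℝ) * (k * (k * (((point P i).dot (point P i)).val : ℝ)) / k) =
      k * (D n * ((point P i).dot (point P i)).val) by field_simp]
    exact mul_lt_mul_of_pos_left (by linarith) hk'
  · intro n hn r hr
    have key : ∀ a b c d : ℕ, tetVertex n r = a →
        (∀ i, i ≠ a → i ∈ tetSet n → i = b ∨ i = c ∨ i = d) →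
        M.any (isFacetOf (point P a) (point P b) (point P c) (point P d)) = true →
        ∃ m : Euc 3 →ᵃ[ℝ] ℝ, (∀ x ∈ S, 0 ≤ m x) ∧ (∀ i ∈ (tetSet n).erase (tetVertex n r),
          m ((k : ℝ) • (point P i).toEuc) = 0) ∧
          0 < m ((k : ℝ) • (point P (tetVertex n r)).toEuc) := by
      rintro a b c d rfl hi hany
      obtain ⟨m, hm, hb, hc, hd, ha⟩ := isFacetOf_spec hany
      refine ⟨affineFunctional k m.1 m.2.val, fun x hx => ?_, fun i hi' => ?_, ?_⟩
      · rw [hSM] at hx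
        exact hx m hm
      · rw [affineFunctional_smul]
        rcases hi i (Finset.ne_of_mem_erase hi') (Finset.mem_of_mem_erase hi') with rfl | rfl | rfl
        · rw [hb, Int.cast_zero, mul_zero]
        · rw [hc, Int.cast_zero, mul_zero]
        · rw [hd, Int.cast_zero, mul_zero]
      · rw [affineFunctional_smul]
        exact mul_pos hk' (Int.cast_pos.2 ha)
    obtain ⟨⟨⟨⟨-, h0⟩, h1⟩, h2⟩, h3⟩ := h n hn
    interval_cases r
    · exact h0.imp_right (key _ _ _ _ rfl fun i hne hi => by
        rcases mem_tetSet.1 hi with rfl | h | h | h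
        all_goals first | exact absurd rfl hne | simp only [h, true_or, or_true])
    · exact h1.imp_right (key _ _ _ _ rfl fun i hne hi => by
        rcases mem_tetSet.1 hi with h | rfl | h | h
        all_goals first | exact absurd rfl hne | simp only [h, true_or, or_true])
    · exact h2.imp_right (key _ _ _ _ rfl fun i hne hi => by
        rcases mem_tetSet.1 hi with h | h | rfl | h
        all_goals first | exact absurd rfl hne | simp only [h, true_or, or_true])
    · exact h3.imp_right (key _ _ _ _ rfl fun i hne hi => by
        rcases mem_tetSet.1 hi with h | h | h | rfl
        all_goals first | exact absurd rfl hne | simp only [h, true_or, or_true])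
  · intro n hn t ht
    have h := (h n hn).1.1.1.1.1
    simp only [isAcute, Bool.and_eq_true] at h
    obtain ⟨⟨⟨⟨⟨h1, h2⟩, h3⟩, h4⟩, h5⟩, h6⟩ := h
    refine AcuteAt.isAcuteSimplex (fun v hv => ?_) (acuteAt_of_isAcuteAt h1 hk')
      (acuteAt_of_isAcuteAt h2 hk') (acuteAt_of_isAcuteAt h3 hk') (acuteAt_of_isAcuteAt h4 hk')
      (acuteAt_of_isAcuteAt h5 hk') (acuteAt_of_isAcuteAt h6 hk')
    obtain ⟨i, hi, rfl⟩ := ht v hv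
    rcases mem_tetSet.1 hi with rfl | rfl | rfl | rfl <;> simp
  · intro i j
    have : ∃ m : ℤ, (point P i).toEuc j = m := by
      fin_cases j
      exacts [⟨_, rfl⟩, ⟨_, rfl⟩, ⟨_, rfl⟩]
    obtain ⟨m, hm⟩ := this
    exact ⟨k * m, by rw [PiLp.smul_apply, hm, smul_eq_mul]; push_cast; rfl⟩

/-! ### The two tetrahedra -/

theorem mem_convexHull_of_four {a b c d x : Euc 3} {p q r s : ℝ} (hp : 0 ≤ p) (hq : 0 ≤ q)
    (hr : 0 ≤ r) (hs : 0 ≤ s) (h : p + q + r + s = 1) (hx : p • a + q • b + r • c + s • d = x) :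
    x ∈ convexHull ℝ {a, b, c, d} := by
  have ha : a ∈ convexHull ℝ {a, b, c, d} := subset_convexHull ℝ _ (by simp)
  have hb : b ∈ convexHull ℝ {a, b, c, d} := subset_convexHull ℝ _ (by simp)
  have hc : c ∈ convexHull ℝ {a, b, c, d} := subset_convexHull ℝ _ (by simp)
  have hd : d ∈ convexHull ℝ {a, b, c, d} := subset_convexHull ℝ _ (by simp)
  have := (convex_convexHull ℝ {a, b, c, d}).sum_mem (t := Finset.univ) (w := ![p, q, r, s])
    (z := ![a, b, c, d]) (fun i _ => by fin_cases i <;> simpa)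
    (by simpa [Fin.sum_univ_four] using h) (fun i _ => by fin_cases i <;> simpa)
  rw [← hx]
  simpa [Fin.sum_univ_four] using this

theorem convex_setOf_affineFunctional_nonneg (k : ℝ) (M : List (DiffVec × Diff)) :
    Convex ℝ {x | ∀ m ∈ M, 0 ≤ affineFunctional k m.1 m.2.val x} := by
  simp only [Set.ofPred_forall]
  exact convex_iInter₂ fun m _ => (convex_Ici (0 : ℝ)).affine_preimage _

theorem affineFunctional_eq (k : ℝ) (g : DiffVec) (c : ℤ) (x : Euc 3) :
    affineFunctional k g c x = g.x.val * x 0 + g.y.val * x 1 + g.z.val * x 2 + k * c := by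
  rw [affineFunctional_apply, PiLp.inner_apply, Fin.sum_univ_three]
  simp [DiffVec.toEuc, mul_comm]

theorem regularSimplex_eq : regularSimplex =
    {x | ∀ m ∈ regularFacets, 0 ≤ affineFunctional (600 : ℤ) m.1 m.2.val x} := by
  refine Set.Subset.antisymm
    (convexHull_min ?_ (convex_setOf_affineFunctional_nonneg _ _)) fun x hx => ?_
  · rintro v (rfl | rfl | rfl | rfl) <;>
      simp [regularFacets, affineFunctional_eq, Diff.val] <;> norm_num
  · simp only [regularFacets, Set.mem_ofPred_eq, List.forall_mem_cons, affineFunctional_eq,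
      Diff.val] at hx
    norm_num at hx
    obtain ⟨h1, h2, h3, h4⟩ := hx
    -- The weights are the facet functionals divided by 120000, their value at the opposite vertex.
    refine mem_convexHull_of_four (p := (60000 + x 0 - x 1 - x 2) / 120000)
      (q := (x 0 + x 1 + x 2 - 60000) / 120000) (r := (60000 + x 2 - x 0 - x 1) / 120000)
      (s := (60000 + x 1 - x 0 - x 2) / 120000) (by linarith) (by linarith) (by linarith)
      (by linarith) (by ring) ?_
    ext i
    fin_cases i <;> simp <;> ring

theorem standardSimplex_eq : standardSimplex =
    {x | ∀ m ∈ standardFacets, 0 ≤ affineFunctional (80 : ℤ) m.1 m.2.val x} := by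
  refine Set.Subset.antisymm
    (convexHull_min ?_ (convex_setOf_affineFunctional_nonneg _ _)) fun x hx => ?_
  · rintro v (rfl | rfl | rfl | rfl) <;>
      simp [standardFacets, affineFunctional_eq, Diff.val] <;> norm_num
  · simp only [standardFacets, Set.mem_ofPred_eq, List.forall_mem_cons, affineFunctional_eq,
      Diff.val] at hx
    norm_num at hx
    obtain ⟨h1, h2, h3, h4⟩ := hx
    -- The barycentric coordinates; here a grid length of 750 with scale 80 is again 60000.
    refine mem_convexHull_of_four (p := 1 - x 0 / 60000 - x 1 / 60000 - x 2 / 60000)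
      (q := x 0 / 60000) (r := x 1 / 60000) (s := x 2 / 60000) (by linarith) (by linarith)
      (by linarith) (by linarith) (by ring) ?_
    ext i
    fin_cases i <;> simp

end AcuteTriangulations

theorem theorem2p6
    (σ : Finset (AcuteTriangulations.Euc 4))
    (hσ : σ ∈ AcuteTriangulations.X600.faces) (hcard : σ.card = 4) :
    (∃ K : Geometry.SimplicialComplex ℝ (AcuteTriangulations.Euc 3),
      AcuteTriangulations.IsAcuteTriangulation K AcuteTriangulations.regularSimplex ∧
      AcuteTriangulations.CombinatoriallyEquivalent K.toPreAbstractSimplicialComplex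
        (AcuteTriangulations.X543 σ) ∧
      (AcuteTriangulations.tetrahedra K).ncard = 543 ∧
      ∀ v ∈ K.vertices, ∀ i, ∃ m : ℤ, v i = (m : ℝ)) ∧
    (∃ K : Geometry.SimplicialComplex ℝ (AcuteTriangulations.Euc 3),
      AcuteTriangulations.IsAcuteTriangulation K AcuteTriangulations.standardSimplex ∧
      AcuteTriangulations.CombinatoriallyEquivalent K.toPreAbstractSimplicialComplex
        (AcuteTriangulations.X543 σ) ∧
      (AcuteTriangulations.tetrahedra K).ncard = 543 ∧
      ∀ v ∈ K.vertices, ∀ i, ∃ m : ℤ, v i = (m : ℝ)) :=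
  ⟨AcuteTriangulations.exists_of_isGood AcuteTriangulations.regular_check (by norm_num)
    (convex_convexHull ℝ _) AcuteTriangulations.regularSimplex_eq hσ hcard,
   AcuteTriangulations.exists_of_isGood AcuteTriangulations.standard_check (by norm_num)
    (convex_convexHull ℝ _) AcuteTriangulations.standardSimplex_eq hσ hcard⟩
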